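/- **Setting.** Let $M$ be a smooth (Hausdorff) $n$-manifold with a Carnot structure of step $r\ge 1$, i.e. a filtration of smooth subbundles $H_1\subset H_2\subset\cdots\subset H_r=TM$ (of constant ranks) such that $[H_v,H_{v'}]\subset H_{v+v'}$ whenever $v+v'\le r$. Its weight sequence is $w_j=\min\{v\in\{1,\dots,r\}: j\le \operatorname{rk}H_v\}$, $1\le j\le n$. Let $a\in M$, let $x=(x_1,\dots,x_n)$ be smooth local coordinates centered at $a$ with domain $V\subset M$ and range $U\subset\mathbb{R}^n$, and let $(X_1,\dots,X_n)$ be an $H$-frame over $V$, i.e. a smooth tangent frame such that each $X_j$ is a section of $H_{w_j}$. In the coordinates $x$ we regard the $X_j$ as vector fields on $U$. The coordinates are *linearly adapted* to $(X_1,\dots,X_n)$ at $a$ if $X_j(0)=\partial_j$ for all $j$. For $\alpha\in\mathbb{N}_0^n$ put $\langle\alpha\rangle=\sum_j w_j\alpha_j$ and $X^\alpha=X_1^{\alpha_1}\cdots X_n^{\alpha_n}$. For $t\ne 0$ put $\delta_t(x)=(t^{w_1}x_1,\dots,t^{w_n}x_n)$. * A smooth function $f$ near $a$ has *order $N$* at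 $a$ if $X_{i_1}\cdots X_{i_k}f(a)=0$ for every finite sequence (possibly empty) with $w_{i_1}+\cdots+w_{i_k}<N$, and $X_{i_1}\cdots X_{i_k}f(a)\neq0$ for some sequence with $w_{i_1}+\cdots+w_{i_k}=N$. * A smooth function $f$ near $0\in\mathbb{R}^n$ has *weight $\ge N$* ($N\in\mathbb{Z}$) if $\partial^\alpha f(0)=0$ whenever $\langle\alpha\rangle<N$; it has *weight $N$* if moreover $\partial^\alpha f(0)\ne0$ for some $\alpha$ with $\langle\alpha\rangle=N$. * A differential operator $P=\sum_{|\alpha|\le m}a_\alpha(x)\partial^\alpha$ with coefficients in $C^\infty(U)$ has *weight $N\in\mathbb{Z}$* if every $a_\alpha$ has weight $\ge N+\langle\alpha\rangle$ and at least one $a_\alpha$ has weight $N+\langle\alpha\rangle$. * A smooth vector field $Z$ on $\mathbb{R}^n$ is *homogeneous of degree $d$* if $\delta_t^*Z=t^dZ$ for all $t\in\mathbb{R}\setminus\{0\}$. The coordinates are *privileged coordinates* at $a$ adapted to $(X_1,\dots,X_n)$ (in the sense of Bellaïche–Stefani) if they are linearly adapted and each coordinate function $x_k$ has order $w_k$ at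 $a$. **Theorem 5.1.** Assume that the coordinates are linearly adapted to $(X_1,\dots,X_n)$ at $a$. Then the following are equivalent: 1. The coordinates $(x_1,\dots,x_n)$ are privileged coordinates at $a$. 2. For each $j=1,\dots,n$ there is a smooth vector field $X_j^{(a)}$ on $\mathbb{R}^n$, homogeneous of degree $-w_j$, such that, as $t\to0$, $t\neq 0$, $$t^{w_j}\delta_t^*X_j=X_j^{(a)}+\mathrm{O}(t)$$ in the $C^\infty$ topology of vector fields on $U$, i.e. for every compact $K\subset U$ and every $\alpha\in\mathbb{N}_0^n$, the $\partial^\alpha$-derivatives of the components of $t^{w_j}\delta_t^*X_j-X_j^{(a)}$ are $\mathrm{O}(t)$ uniformly on $K$. 3. For each $j=1,\dots,n$, the vector field $X_j$ has weight $-w_j$ in the coordinates $(x_1,\dots,x_n)$. 4. For every $\alpha\in\mathbb{N}_0^n$, the differential operator $X^\alpha$ has weight $-\langle\alpha\rangle$ in the coordinates $(x_1,\dots,x_n)$. Consequently (for arbitrary local coordinates centered at $a$), the coordinates are privileged in the sense of Bellaïche–Stefani if and only if they are privileged in the sense of Goodman, i.e. linearly adapted and satisfying condition 2. -/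

import Mathlib

open scoped Manifold ContDiff Topology

noncomputable section

namespace Carnot

/-- The model space `ℝⁿ`. -/
abbrev Rn (n : ℕ) : Type := EuclideanSpace ℝ (Fin n)

/-! ### Iterated operators -/

/-- The ordered monomial `D₁^{α₁} ∘ ⋯ ∘ Dₙ^{αₙ}` in a family of operators. -/
def monomial {n : ℕ} {F : Type*} (D : Fin n → F → F) (α : Fin n → ℕ) : F → F :=
  (List.ofFn fun i => (D i)^[α i]).foldr (fun S T => S ∘ T) id

/-- A vector field `Y` on (an open subset of) `ℝⁿ` acting on functions: `(Y u)(x) = du(x)(Y(x))`. -/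
def vfOp {n : ℕ} (Y : Rn n → Rn n) (u : Rn n → ℝ) : Rn n → ℝ :=
  fun x => fderiv ℝ u x (Y x)

/-- The iterated partial derivative `∂^α = ∂₁^{α₁} ⋯ ∂ₙ^{αₙ}`. -/
def partialDeriv {n : ℕ} (α : Fin n → ℕ) : (Rn n → ℝ) → Rn n → ℝ :=
  monomial (fun i => vfOp fun _ => EuclideanSpace.single i (1 : ℝ)) α

/-- The multi-orders `α ∈ ℕ₀ⁿ` with `|α| = α₁ + ⋯ + αₙ ≤ m`. -/
def multiOrders (n m : ℕ) : Finset (Fin n → ℕ) :=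
  (Fintype.piFinset fun _ => Finset.range (m + 1)).filter fun α => ∑ i, α i ≤ m

theorem mem_multiOrders {n m : ℕ} {α : Fin n → ℕ} :
    α ∈ multiOrders n m ↔ ∑ i, α i ≤ m := by
  simp only [multiOrders, Finset.mem_filter, Fintype.mem_piFinset, Finset.mem_range,
    and_iff_right_iff_imp]
  intro h i
  exact Nat.lt_succ_of_le
    ((Finset.single_le_sum (f := α) (fun _ _ => Nat.zero_le _) (Finset.mem_univ i)).trans h)

/-- The weighted length `⟨α⟩ = w₁ α₁ + ⋯ + wₙ αₙ`. -/
def wlen {n : ℕ} (w : Fin n → ℕ) (α : Fin n → ℕ) : ℕ := ∑ i, w i * α i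

/-! ### Anisotropic weights on `ℝⁿ` -/

/-- A function defined near `0` has weight `≥ N`: `∂^α f(0) = 0` whenever `⟨α⟩ < N`.
For `N ≤ 0` this holds for every function. -/
def WeightGE {n : ℕ} (w : Fin n → ℕ) (f : Rn n → ℝ) (N : ℤ) : Prop :=
  ∀ α : Fin n → ℕ, (wlen w α : ℤ) < N → partialDeriv α f 0 = 0

/-- A function defined near `0` has weight (exactly) `N`. -/
def HasWeight {n : ℕ} (w : Fin n → ℕ) (f : Rn n → ℝ) (N : ℤ) : Prop :=
  WeightGE w f N ∧ ∃ α : Fin n → ℕ, (wlen w α : ℤ) = N ∧ partialDeriv α f 0 ≠ 0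

/-- `P = ∑_{|α| ≤ m} a_α ∂^α` as operators on `C^∞(U)`, with coefficients `a_α ∈ C^∞(U)`. -/
def IsDiffOpOn {n : ℕ} (U : Set (Rn n)) (m : ℕ) (a : (Fin n → ℕ) → Rn n → ℝ)
    (P : (Rn n → ℝ) → Rn n → ℝ) : Prop :=
  (∀ α ∈ multiOrders n m, ContDiffOn ℝ ∞ (a α) U) ∧
  ∀ u : Rn n → ℝ, ContDiffOn ℝ ∞ u U → ∀ x ∈ U,
    P u x = ∑ α ∈ multiOrders n m, a α x * partialDeriv α u x

/-- `P` is a differential operator on the open set `U ∋ 0` which has weight `N`: in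
`P = ∑_{|α| ≤ m} a_α ∂^α`, every coefficient `a_α` has weight `≥ N + ⟨α⟩` and at least one of them
has weight `N + ⟨α⟩`. (The coefficients are uniquely determined by `P` on `U`.) -/
def DiffOpHasWeight {n : ℕ} (w : Fin n → ℕ) (U : Set (Rn n))
    (P : (Rn n → ℝ) → Rn n → ℝ) (N : ℤ) : Prop :=
  ∃ (m : ℕ) (a : (Fin n → ℕ) → Rn n → ℝ), IsDiffOpOn U m a P ∧
    (∀ α ∈ multiOrders n m, WeightGE w (a α) (N + wlen w α)) ∧
    ∃ α ∈ multiOrders n m, HasWeight w (a α) (N + wlen w α)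

/-- The dilation `δ_t(x) = t · x = (t^{w₁} x₁, …, t^{wₙ} xₙ)`. -/
def dilation {n : ℕ} (w : Fin n → ℕ) (t : ℝ) (x : Rn n) : Rn n :=
  WithLp.toLp 2 fun k => t ^ w k * x k

/-- A vector field `Z` on `ℝⁿ` is homogeneous of degree `d`: `δ_t^* Z = t^d Z` for all `t ≠ 0`. -/
def VFHomogeneous {n : ℕ} (w : Fin n → ℕ) (Z : Rn n → Rn n) (d : ℤ) : Prop :=
  ∀ t : ℝ, t ≠ 0 → ∀ x : Rn n, VectorField.pullback ℝ (dilation w t) Z x = t ^ d • Z x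

/-- `Z_t = O(t)` in `𝒳(U) ≃ C^∞(U, ℝⁿ)` as `t → 0`, `t ≠ 0`: for each compact `K ⊆ U`, each
multi-order `α` and each component `k`, one has `sup_K |∂^α (Z_t)_k| = O(t)`. -/
def IsBigOtInVF {n : ℕ} (U : Set (Rn n)) (Z : ℝ → Rn n → Rn n) : Prop :=
  ∀ K : Set (Rn n), IsCompact K → K ⊆ U → ∀ (α : Fin n → ℕ) (k : Fin n),
    ∃ C : ℝ, ∀ᶠ t in 𝓝[≠] (0 : ℝ), ∀ x ∈ K, |partialDeriv α (fun y => Z t y k) x| ≤ C * |t|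

/-- On `U` one has `t^{d} δ_t^* Y = Z + O(t)` in the `C^∞` topology of vector fields on `U`,
for some smooth vector field `Z` on `ℝⁿ` that is homogeneous of degree `-d`. -/
def HasHomogeneousModel {n : ℕ} (w : Fin n → ℕ) (U : Set (Rn n)) (Y : Rn n → Rn n) (d : ℕ) :
    Prop :=
  ∃ Z : Rn n → Rn n, ContDiff ℝ ∞ Z ∧ VFHomogeneous w Z (-(d : ℤ)) ∧
    IsBigOtInVF U fun t x => t ^ d • VectorField.pullback ℝ (dilation w t) Y x - Z x

/-! ### Carnot manifolds -/

section Manifold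

variable {n : ℕ} {M : Type*} [TopologicalSpace M] [ChartedSpace (Rn n) M]
  [IsManifold (𝓡 n) ∞ M]

/-- `X` is a smooth vector field over `V`. -/
def SmoothVFOn (X : (x : M) → TangentSpace (𝓡 n) x) (V : Set M) : Prop :=
  ContMDiffOn (𝓡 n) (𝓡 n).tangent ∞ (fun x => (⟨x, X x⟩ : TangentBundle (𝓡 n) M)) V

/-- `H` is a smooth rank `d` subbundle of `TM`: near every point it is spanned by a smooth frame
of `d` pointwise linearly independent vector fields. -/
def IsSmoothSubbundle
    (H : (x : M) → Submodule ℝ (TangentSpace (𝓡 n) x)) (d : ℕ) : Prop :=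
  ∀ x : M, ∃ W : Set M, IsOpen W ∧ x ∈ W ∧
    ∃ Y : Fin d → (x : M) → TangentSpace (𝓡 n) x, (∀ i, SmoothVFOn (Y i) W) ∧
      ∀ y ∈ W, LinearIndependent ℝ (fun i => Y i y) ∧
        Submodule.span ℝ (Set.range fun i => Y i y) = H y

variable (n M) in
/-- A Carnot manifold structure on the `n`-manifold `M`: a filtration
`H 1 ⊆ ⋯ ⊆ H step = TM` by subbundles such that `[H v, H v'] ⊆ H (v + v')` for `v + v' ≤ step`.
Only the indices `1, …, step` are meaningful. -/
structure CarnotStructure where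
  step : ℕ
  one_le_step : 1 ≤ step
  H : ℕ → (x : M) → Submodule ℝ (TangentSpace (𝓡 n) x)
  rank : ℕ → ℕ
  isSubbundle : ∀ v, 1 ≤ v → v ≤ step → IsSmoothSubbundle (H v) (rank v)
  mono : ∀ v, 1 ≤ v → v + 1 ≤ step → ∀ x, H v x ≤ H (v + 1) x
  top : ∀ x, H step x = ⊤
  bracket : ∀ v v', 1 ≤ v → 1 ≤ v' → v + v' ≤ step →
    ∀ Y Z : (x : M) → TangentSpace (𝓡 n) x,
      SmoothVFOn Y Set.univ → SmoothVFOn Z Set.univ →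
      (∀ x, Y x ∈ H v x) → (∀ x, Z x ∈ H v' x) →
      ∀ x, VectorField.mlieBracket (𝓡 n) Y Z x ∈ H (v + v') x

/-- The weight sequence `w_j = min {v ∈ {1, …, r} ; j ≤ rk H_v}`
(the index `j : Fin n` stands for the `(j + 1)`-st entry). -/
def CarnotStructure.weight (C : CarnotStructure n M) (j : Fin n) : ℕ :=
  sInf {v : ℕ | 1 ≤ v ∧ v ≤ C.step ∧ (j : ℕ) + 1 ≤ C.rank v}

/-- `(X₁, …, Xₙ)` is an `H`-frame over `V`: a smooth tangent frame over `V` such that `X_j` is a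
section of `H_{w_j}`. -/
structure IsHFrameOn (C : CarnotStructure n M)
    (X : Fin n → (x : M) → TangentSpace (𝓡 n) x) (V : Set M) : Prop where
  smooth : ∀ j, SmoothVFOn (X j) V
  linearIndependent : ∀ x ∈ V, LinearIndependent ℝ fun j => X j x
  mem : ∀ j, ∀ x ∈ V, X j x ∈ C.H (C.weight j) x

/-! ### Order of functions and privileged coordinates -/

/-- A vector field on `M` acting on functions: `(X f)(x) = df(x)(X(x))`. -/
def mvfOp (X : (x : M) → TangentSpace (𝓡 n) x) (f : M → ℝ) : M → ℝ :=
  fun x => mfderiv (𝓡 n) 𝓘(ℝ, ℝ) f x (X x)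

/-- `X_I f = X_{i₁} ⋯ X_{i_k} f` for a finite sequence `I = (i₁, …, i_k)`. -/
def seqOp (X : Fin n → (x : M) → TangentSpace (𝓡 n) x) (I : List (Fin n)) (f : M → ℝ) : M → ℝ :=
  I.foldr (fun i g => mvfOp (X i) g) f

/-- `⟨I⟩ = w_{i₁} + ⋯ + w_{i_k}`. -/
def seqWeight (w : Fin n → ℕ) (I : List (Fin n)) : ℕ := (I.map w).sum

/-- The function `f`, smooth near `a`, has order `N` at `a` with respect to the frame `X`. -/
def HasOrder (w : Fin n → ℕ) (X : Fin n → (x : M) → TangentSpace (𝓡 n) x) (a : M)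
    (f : M → ℝ) (N : ℕ) : Prop :=
  (∀ I : List (Fin n), seqWeight w I < N → seqOp X I f a = 0) ∧
    ∃ I : List (Fin n), seqWeight w I = N ∧ seqOp X I f a ≠ 0

/-- `φ` is a system of smooth local coordinates of `M` centered at `a`; its domain is `φ.source`
and its range is `φ.target`. -/
structure IsCenteredChart (φ : OpenPartialHomeomorph M (Rn n)) (a : M) : Prop where
  mem_maximalAtlas : φ ∈ IsManifold.maximalAtlas (𝓡 n) ∞ M
  mem_source : a ∈ φ.source
  map_eq_zero : φ a = 0

/-- The vector field `X` on `φ.source`, seen as a vector field on `φ.target ⊆ ℝⁿ`. -/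
def coordVF (φ : OpenPartialHomeomorph M (Rn n)) (X : (x : M) → TangentSpace (𝓡 n) x) :
    Rn n → Rn n :=
  fun u => mfderiv (𝓡 n) (𝓡 n) φ (φ.symm u) (X (φ.symm u))

/-- The coordinates `φ` centered at `a` are linearly adapted at `a` to `X`: in these coordinates
`X_j(0) = ∂_j`. -/
def LinearlyAdapted (φ : OpenPartialHomeomorph M (Rn n))
    (X : Fin n → (x : M) → TangentSpace (𝓡 n) x) : Prop :=
  ∀ j, coordVF φ (X j) 0 = EuclideanSpace.single j (1 : ℝ)

/-- Privileged coordinates (in the sense of Bellaïche and Stefani) at `a` adapted to the `H`-frame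
`X`: linearly adapted coordinates such that each coordinate function `x_k` has order `w_k`. -/
def IsPrivileged (w : Fin n → ℕ) (φ : OpenPartialHomeomorph M (Rn n)) (a : M)
    (X : Fin n → (x : M) → TangentSpace (𝓡 n) x) : Prop :=
  LinearlyAdapted φ X ∧ ∀ k, HasOrder w X a (fun p => φ p k) (w k)

/-- Privileged coordinates in the sense of Goodman: linearly adapted coordinates such that
`t^{w_j} δ_t^* X_j = X_j^{(a)} + O(t)` with `X_j^{(a)}` homogeneous of degree `-w_j`. -/
def IsGoodmanPrivileged (w : Fin n → ℕ) (φ : OpenPartialHomeomorph M (Rn n))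
    (X : Fin n → (x : M) → TangentSpace (𝓡 n) x) : Prop :=
  LinearlyAdapted φ X ∧ ∀ j, HasHomogeneousModel w φ.target (coordVF φ (X j)) (w j)

end Manifold

end Carnot

end

/-!
Both notions compared by the theorem are filtrations of the germs of functions at `0`: the weight of
a function is its order along the coordinate frame `∂₁, …, ∂ₙ`, and privilege speaks of the order
along `X₁, …, Xₙ`. Order along any frame is superadditive on products and drops by at most `w_j`
under the `j`-th field. Hence, if `X_j = ∑ c_{jk} Y_k` with `c_{jk}` of order at least `w_k - w_j`
along `Y`, a bound on the order along `Y` is also one along `X`. The coordinates are privileged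
exactly when the components `X_j(x_k)` have `X`-order at least `w_k - w_j`; the inverse matrix,
computed by cofactors, obeys the same bounds, so this is the same as weight at least `w_k - w_j`.
These bounds on the components propagate through the Leibniz rule to all `X^α`.

For the rescaled fields, the model is the homogeneous Taylor polynomial of the components. What
remains has weight at least `w_k - w_j + 1`, so integrating along the curves `s ↦ δ_s(x)` gives the
`O(t)` bound; conversely, evaluating the `O(t)` bound at the fixed point `0` of the dilations forces
the low-weight derivatives to vanish.
-/

noncomputable section

namespace Carnot

variable {n : ℕ}

/-! ### Monomials as iterated operators -/

/-- The nondecreasing list of indices in which `i` occurs `α i` times; it lists the factors of the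
ordered monomial with exponent `α`. -/
def indexList (α : Fin n → ℕ) : List (Fin n) :=
  (List.ofFn fun i => List.replicate (α i) i).flatten

theorem monomial_eq_foldr {F : Type*} (D : Fin n → F → F) (α : Fin n → ℕ) (f : F) :
    monomial D α f = (indexList α).foldr D f := by
  have foldr_comp (L : List (Fin n)) :
      ((L.map fun i => (D i)^[α i]).foldr (fun S T => S ∘ T) id) f =
        L.foldr (fun i g => (D i)^[α i] g) f := by
    induction L with
    | nil => rfl
    | cons i L ih => exact congrArg _ ih
  have foldr_replicate (i : Fin n) (g : F) (m : ℕ) :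
      (List.replicate m i).foldr D g = (D i)^[m] g := by
    induction m with
    | zero => rfl
    | succ m ih => rw [List.replicate_succ, List.foldr_cons, ih, Function.iterate_succ_apply']
  simp only [monomial, indexList, List.ofFn_eq_map, foldr_comp, List.foldr_flatten, List.foldr_map,
    foldr_replicate]

theorem count_indexList (α : Fin n → ℕ) (i : Fin n) : (indexList α).count i = α i := by
  rw [indexList, List.count_flatten, List.map_ofFn, List.sum_ofFn]
  simp [List.count_replicate]

theorem perm_indexList_iff {I : List (Fin n)} {α : Fin n → ℕ} :
    I.Perm (indexList α) ↔ ∀ i, I.count i = α i := by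
  simp only [List.perm_iff_count, count_indexList]

theorem length_indexList (α : Fin n → ℕ) : (indexList α).length = ∑ i, α i := by
  rw [indexList, List.length_flatten, List.map_ofFn, List.sum_ofFn]
  simp

theorem seqWeight_indexList (w : Fin n → ℕ) (α : Fin n → ℕ) :
    seqWeight w (indexList α) = wlen w α := by
  rw [seqWeight, wlen, indexList, List.map_flatten, List.sum_flatten, List.map_ofFn, List.map_ofFn,
    List.sum_ofFn]
  simp [mul_comm]

theorem indexList_add_single_perm (α : Fin n → ℕ) (j : Fin n) :
    (j :: indexList α).Perm (indexList (α + Pi.single j 1)) := by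
  simp [perm_indexList_iff, List.count_cons, count_indexList, Pi.single_apply, @eq_comm _ j]

theorem indexList_zero : indexList (0 : Fin n → ℕ) = [] :=
  List.length_eq_zero_iff.1 (by simp [length_indexList])

theorem monomial_single {F : Type*} (D : Fin n → F → F) (j : Fin n) :
    monomial D (Pi.single j 1) = D j := by
  have hj : [j] = indexList (Pi.single j 1) :=
    List.singleton_perm.1 (by simpa [indexList_zero] using indexList_add_single_perm 0 j)
  funext f
  rw [monomial_eq_foldr, ← hj]
  rfl

theorem wlen_add_single (w α : Fin n → ℕ) (j : Fin n) :
    wlen w (α + Pi.single j 1) = wlen w α + w j := by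
  simp [wlen, mul_add, Finset.sum_add_distrib, Pi.single_apply]

theorem wlen_single (w : Fin n → ℕ) (j : Fin n) : wlen w (Pi.single j 1) = w j := by
  simp [wlen, Pi.single_apply]

/-! ### Derivations along vector fields -/

/-- The coordinate vector field `∂_i` on `ℝⁿ`. -/
def coordField (i : Fin n) : Rn n → Rn n := fun _ => EuclideanSpace.single i 1

/-- The iterated derivative `Y_I f = Y_{i₁} ⋯ Y_{i_k} f` along vector fields on `ℝⁿ`; this is the
counterpart of `seqOp` in coordinates. -/
def vfSeqOp (Y : Fin n → Rn n → Rn n) (I : List (Fin n)) (f : Rn n → ℝ) : Rn n → ℝ :=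
  I.foldr (fun i => vfOp (Y i)) f

section Derivations

variable {Y : Fin n → Rn n → Rn n} {Z : Rn n → Rn n} {f g : Rn n → ℝ} {p : Rn n}

@[simp] theorem vfSeqOp_nil : vfSeqOp Y [] f = f := rfl

@[simp] theorem vfSeqOp_cons (i : Fin n) (I : List (Fin n)) :
    vfSeqOp Y (i :: I) f = vfOp (Y i) (vfSeqOp Y I f) := rfl

theorem vfSeqOp_append (I J : List (Fin n)) :
    vfSeqOp Y (I ++ J) f = vfSeqOp Y I (vfSeqOp Y J f) :=
  List.foldr_append

theorem monomial_vfOp_eq_vfSeqOp (α : Fin n → ℕ) :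
    monomial (fun i => vfOp (Y i)) α f = vfSeqOp Y (indexList α) f :=
  monomial_eq_foldr _ _ _

theorem partialDeriv_eq_vfSeqOp (α : Fin n → ℕ) :
    partialDeriv α f = vfSeqOp coordField (indexList α) f :=
  monomial_eq_foldr _ _ _

theorem sum_smul_single (y : Rn n) : ∑ k, y k • EuclideanSpace.single k (1 : ℝ) = y := by
  ext i
  simp [Pi.single_apply]

theorem vfOp_sum_smul (c : Fin n → Rn n → ℝ) (f : Rn n → ℝ) (x : Rn n) :
    vfOp (fun y => ∑ k, c k y • Y k y) f x = ∑ k, c k x * vfOp (Y k) f x := by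
  simp [vfOp]

theorem vfOp_eq_sum (Z : Rn n → Rn n) (f : Rn n → ℝ) (x : Rn n) :
    vfOp Z f x = ∑ k, Z x k * vfOp (coordField k) f x := by
  rw [← vfOp_sum_smul (fun k y => Z y k)]
  simp only [coordField, sum_smul_single]

theorem vfOp_coord (Z : Rn n → Rn n) (k : Fin n) : vfOp Z (fun x => x k) = fun x => Z x k := by
  funext x
  have h : HasFDerivAt (fun x : Rn n => x k) (EuclideanSpace.proj k : Rn n →L[ℝ] ℝ) x :=
    (EuclideanSpace.proj k : Rn n →L[ℝ] ℝ).hasFDerivAt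
  rw [vfOp, h.fderiv]
  rfl

theorem vfOp_const (Z : Rn n → Rn n) (c : ℝ) : vfOp Z (fun _ => c) = fun _ => 0 := by
  funext x
  simp [vfOp]

theorem vfOp_const_mul (Z : Rn n → Rn n) (c : ℝ) (f : Rn n → ℝ) :
    vfOp Z (fun x => c * f x) = fun x => c * vfOp Z f x := by
  funext x
  change fderiv ℝ (c • f) x (Z x) = _
  rw [fderiv_const_smul_field]
  rfl

theorem vfSeqOp_const_mul (Y : Fin n → Rn n → Rn n) (I : List (Fin n)) (c : ℝ) (f : Rn n → ℝ) :
    vfSeqOp Y I (fun x => c * f x) = fun x => c * vfSeqOp Y I f x := by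
  induction I with
  | nil => rfl
  | cons i I ih => rw [vfSeqOp_cons, ih, vfOp_const_mul, vfSeqOp_cons]

theorem contDiff_coord (k : Fin n) : ContDiff ℝ ∞ (fun x : Rn n => x k) :=
  (EuclideanSpace.proj k : Rn n →L[ℝ] ℝ).contDiff

theorem contDiffAt_component (hZ : ContDiffAt ℝ ∞ Z p) (k : Fin n) :
    ContDiffAt ℝ ∞ (fun x => Z x k) p :=
  (contDiff_coord k).contDiffAt.comp p hZ

theorem contDiffAt_vfOp (hZ : ContDiffAt ℝ ∞ Z p) (hf : ContDiffAt ℝ ∞ f p) :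
    ContDiffAt ℝ ∞ (vfOp Z f) p :=
  (hf.fderiv_right (m := ∞) (by simp)).clm_apply hZ

theorem contDiffAt_vfSeqOp (hY : ∀ i, ContDiffAt ℝ ∞ (Y i) p) (hf : ContDiffAt ℝ ∞ f p)
    (I : List (Fin n)) : ContDiffAt ℝ ∞ (vfSeqOp Y I f) p := by
  induction I with
  | nil => exact hf
  | cons i I ih => exact contDiffAt_vfOp (hY i) ih

theorem contDiffAt_coordField (i : Fin n) : ContDiffAt ℝ ∞ (coordField i) p := contDiffAt_const

theorem contDiffAt_partialDeriv (hf : ContDiffAt ℝ ∞ f p) (α : Fin n → ℕ) :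
    ContDiffAt ℝ ∞ (partialDeriv α f) p := by
  rw [partialDeriv_eq_vfSeqOp]
  exact contDiffAt_vfSeqOp contDiffAt_coordField hf _

theorem eventually_differentiableAt {E : Type*} [NormedAddCommGroup E] [NormedSpace ℝ E] {f : E → ℝ}
    {p : E} (hf : ContDiffAt ℝ ∞ f p) : ∀ᶠ x in 𝓝 p, DifferentiableAt ℝ f x :=
  ((hf.of_le (m := 1) (by simp)).eventually (by simp)).mono fun _ h =>
    h.differentiableAt one_ne_zero

theorem vfOp_congr (h : f =ᶠ[𝓝 p] g) (Z : Rn n → Rn n) : vfOp Z f =ᶠ[𝓝 p] vfOp Z g :=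
  h.fderiv.mono fun x hx => by rw [vfOp, vfOp, hx]

theorem vfSeqOp_congr (h : f =ᶠ[𝓝 p] g) (I : List (Fin n)) :
    vfSeqOp Y I f =ᶠ[𝓝 p] vfSeqOp Y I g := by
  induction I with
  | nil => exact h
  | cons i I ih => exact vfOp_congr ih (Y i)

theorem vfOp_mul (hf : ContDiffAt ℝ ∞ f p) (hg : ContDiffAt ℝ ∞ g p) (Z : Rn n → Rn n) :
    vfOp Z (fun x => f x * g x) =ᶠ[𝓝 p] fun x => vfOp Z f x * g x + f x * vfOp Z g x := by
  filter_upwards [eventually_differentiableAt hf, eventually_differentiableAt hg] with x hfx hgx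
  simp only [vfOp, fderiv_fun_mul hfx hgx, FunLike.coe_add, FunLike.coe_smul, Pi.add_apply,
    Pi.smul_apply, smul_eq_mul]
  ring

theorem vfOp_sum {ι : Type*} {s : Finset ι} {F : ι → Rn n → ℝ}
    (hF : ∀ i ∈ s, ContDiffAt ℝ ∞ (F i) p) (Z : Rn n → Rn n) :
    vfOp Z (fun x => ∑ i ∈ s, F i x) =ᶠ[𝓝 p] fun x => ∑ i ∈ s, vfOp Z (F i) x := by
  filter_upwards [(Finset.eventually_all s).2 fun i hi => eventually_differentiableAt (hF i hi)]
    with x hx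
  simp [vfOp, fderiv_fun_sum hx]

theorem vfSeqOp_sum {ι : Type*} {s : Finset ι} {F : ι → Rn n → ℝ}
    (hY : ∀ j, ContDiffAt ℝ ∞ (Y j) p) (hF : ∀ i ∈ s, ContDiffAt ℝ ∞ (F i) p) (I : List (Fin n)) :
    vfSeqOp Y I (fun x => ∑ i ∈ s, F i x) =ᶠ[𝓝 p] fun x => ∑ i ∈ s, vfSeqOp Y I (F i) x := by
  induction I with
  | nil => rfl
  | cons j I ih =>
    exact (vfOp_congr ih _).trans (vfOp_sum (fun i hi => contDiffAt_vfSeqOp hY (hF i hi) I) _)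

theorem vfSeqOp_add (hY : ∀ j, ContDiffAt ℝ ∞ (Y j) p) (hf : ContDiffAt ℝ ∞ f p)
    (hg : ContDiffAt ℝ ∞ g p) (I : List (Fin n)) :
    vfSeqOp Y I (fun x => f x + g x) =ᶠ[𝓝 p] fun x => vfSeqOp Y I f x + vfSeqOp Y I g x := by
  simpa using vfSeqOp_sum (s := Finset.univ) (F := ![f, g]) hY
    (fun i _ => by fin_cases i <;> assumption) I

theorem vfOp_coordField_comm (hf : ContDiffAt ℝ ∞ f p) (i j : Fin n) :
    vfOp (coordField i) (vfOp (coordField j) f) =ᶠ[𝓝 p]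
      vfOp (coordField j) (vfOp (coordField i) f) := by
  filter_upwards [(hf.of_le (m := 2) (WithTop.coe_le_coe.2 le_top)).eventually (by simp)] with x hx
  have hd : DifferentiableAt ℝ (fderiv ℝ f) x :=
    (hx.fderiv_right (m := 1) le_rfl).differentiableAt one_ne_zero
  have second (k l : Fin n) : vfOp (coordField k) (vfOp (coordField l) f) x =
      fderiv ℝ (fderiv ℝ f) x (EuclideanSpace.single k 1) (EuclideanSpace.single l 1) := by
    change fderiv ℝ (fun y => fderiv ℝ f y (EuclideanSpace.single l 1)) x _ = _
    rw [fderiv_clm_apply hd (differentiableAt_const _)]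
    simp [coordField]
  rw [second, second, (hx.isSymmSndFDerivAt (by simp)).eq]

theorem vfSeqOp_coordField_perm {I J : List (Fin n)} (h : I.Perm J) (hf : ContDiffAt ℝ ∞ f p) :
    vfSeqOp coordField I f =ᶠ[𝓝 p] vfSeqOp coordField J f := by
  induction h with
  | nil => rfl
  | cons i _ ih => exact vfOp_congr ih _
  | swap i j I => exact vfOp_coordField_comm (contDiffAt_vfSeqOp contDiffAt_coordField hf I) _ _
  | trans _ _ ih₁ ih₂ => exact ih₁.trans ih₂

theorem vfOp_partialDeriv (hf : ContDiffAt ℝ ∞ f p) (Z : Rn n → Rn n) (α : Fin n → ℕ) :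
    vfOp Z (partialDeriv α f) =ᶠ[𝓝 p]
      fun x => ∑ k, Z x k * partialDeriv (α + Pi.single k 1) f x := by
  have h (k : Fin n) : vfOp (coordField k) (partialDeriv α f) =ᶠ[𝓝 p]
      partialDeriv (α + Pi.single k 1) f := by
    rw [partialDeriv_eq_vfSeqOp, partialDeriv_eq_vfSeqOp]
    exact vfSeqOp_coordField_perm (indexList_add_single_perm α k) hf
  filter_upwards [Filter.eventually_all.2 h] with x hx
  rw [vfOp_eq_sum]
  simp only [hx]

end Derivations

/-! ### The order of a function along a frame -/

/-- `f` has order at least `N` at `p` along the vector fields `Y`, where `Y i` counts with weight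
`w i`. The order `N` is an integer so that differences of weights can be used; for `N ≤ 0` there is
no condition. -/
def OrderGE (w : Fin n → ℕ) (Y : Fin n → Rn n → Rn n) (p : Rn n) (f : Rn n → ℝ) (N : ℤ) : Prop :=
  ∀ I : List (Fin n), (seqWeight w I : ℤ) < N → vfSeqOp Y I f p = 0

section Order

variable {w : Fin n → ℕ} {Y : Fin n → Rn n → Rn n} {p : Rn n} {f g : Rn n → ℝ} {N N' : ℤ}

theorem seqWeight_concat (w : Fin n → ℕ) (I : List (Fin n)) (i : Fin n) :
    seqWeight w (I ++ [i]) = seqWeight w I + w i := by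
  simp [seqWeight]

theorem seqWeight_cons (w : Fin n → ℕ) (i : Fin n) (I : List (Fin n)) :
    seqWeight w (i :: I) = w i + seqWeight w I :=
  List.sum_cons

theorem OrderGE.mono (h : OrderGE w Y p f N) (hN : N' ≤ N) : OrderGE w Y p f N' :=
  fun I hI => h I (hI.trans_le hN)

theorem OrderGE.congr (h : OrderGE w Y p f N) (hfg : g =ᶠ[𝓝 p] f) : OrderGE w Y p g N :=
  fun I hI => (vfSeqOp_congr hfg I).self_of_nhds.trans (h I hI)

theorem OrderGE.of_nonpos (hN : N ≤ 0) : OrderGE w Y p f N :=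
  fun _ hI => absurd (hI.trans_le hN) (by omega)

theorem OrderGE.toNat (h : OrderGE w Y p f N) : OrderGE w Y p f N.toNat := by
  rcases le_total N 0 with hN | hN
  · exact of_nonpos (by simpa using hN)
  · rwa [Int.toNat_of_nonneg hN]

theorem orderGE_zero : OrderGE w Y p (fun _ => 0) N := by
  intro I _
  simpa using congrFun (vfSeqOp_const_mul Y I 0 (fun _ => 0)) p

theorem OrderGE.const_mul (h : OrderGE w Y p f N) (c : ℝ) :
    OrderGE w Y p (fun x => c * f x) N := by
  intro I hI
  simp only [vfSeqOp_const_mul, h I hI, mul_zero]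

theorem OrderGE.sum {ι : Type*} {s : Finset ι} {F : ι → Rn n → ℝ}
    (hY : ∀ j, ContDiffAt ℝ ∞ (Y j) p) (hF : ∀ i ∈ s, ContDiffAt ℝ ∞ (F i) p)
    (h : ∀ i ∈ s, OrderGE w Y p (F i) N) : OrderGE w Y p (fun x => ∑ i ∈ s, F i x) N := by
  intro I hI
  rw [(vfSeqOp_sum hY hF I).self_of_nhds]
  exact Finset.sum_eq_zero fun i hi => h i hi I hI

theorem OrderGE.add (hY : ∀ j, ContDiffAt ℝ ∞ (Y j) p) (hf : ContDiffAt ℝ ∞ f p)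
    (hg : ContDiffAt ℝ ∞ g p) (hfN : OrderGE w Y p f N) (hgN : OrderGE w Y p g N) :
    OrderGE w Y p (fun x => f x + g x) N := by
  intro I hI
  simpa only [hfN I hI, hgN I hI, add_zero] using (vfSeqOp_add hY hf hg I).self_of_nhds

theorem orderGE_iff : OrderGE w Y p f N ↔
    (0 < N → f p = 0) ∧ ∀ i, OrderGE w Y p (vfOp (Y i) f) (N - w i) := by
  constructor
  · refine fun h => ⟨fun hN => h [] hN, fun i I hI => ?_⟩
    have := h (I ++ [i]) (by rw [seqWeight_concat]; omega)
    rwa [vfSeqOp_append] at this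
  · rintro ⟨eval, deriv⟩ I hI
    rcases List.eq_nil_or_concat I with rfl | ⟨J, i, rfl⟩
    · exact eval hI
    · rw [List.concat_eq_append, seqWeight_concat] at hI
      rw [List.concat_eq_append, vfSeqOp_append]
      exact deriv i J (by omega)

theorem OrderGE.apply_frame (h : OrderGE w Y p f N) (i : Fin n) :
    OrderGE w Y p (vfOp (Y i) f) (N - w i) :=
  (orderGE_iff.1 h).2 i

theorem OrderGE.mul (hY : ∀ j, ContDiffAt ℝ ∞ (Y j) p) (hf : ContDiffAt ℝ ∞ f p)
    (hg : ContDiffAt ℝ ∞ g p) (hfN : OrderGE w Y p f N) (hgN : OrderGE w Y p g N') :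
    OrderGE w Y p (fun x => f x * g x) (N + N') := by
  intro I
  induction I using List.reverseRecOn generalizing f g N N' with
  | nil =>
    intro hI
    have : 0 < N ∨ 0 < N' := by simp only [seqWeight, List.map_nil, List.sum_nil] at hI; omega
    rcases this with h | h
    · simp [(orderGE_iff.1 hfN).1 h]
    · simp [(orderGE_iff.1 hgN).1 h]
  | append_singleton I i ih =>
    intro hI
    rw [seqWeight_concat] at hI
    have hf' := contDiffAt_vfOp (hY i) hf
    have hg' := contDiffAt_vfOp (hY i) hg
    rw [vfSeqOp_append, vfSeqOp_cons, vfSeqOp_nil,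
      (vfSeqOp_congr (vfOp_mul hf hg (Y i)) I).self_of_nhds]
    simpa only [ih hf' hg (hfN.apply_frame i) hgN (by omega),
      ih hf hg' hfN (hgN.apply_frame i) (by omega), add_zero] using
      (vfSeqOp_add hY (hf'.mul hg) (hf.mul hg') I).self_of_nhds

theorem OrderGE.prod {ι : Type*} {s : Finset ι} {F : ι → Rn n → ℝ} {N : ι → ℤ}
    (hY : ∀ j, ContDiffAt ℝ ∞ (Y j) p) (hF : ∀ i ∈ s, ContDiffAt ℝ ∞ (F i) p)
    (h : ∀ i ∈ s, OrderGE w Y p (F i) (N i)) :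
    OrderGE w Y p (fun x => ∏ i ∈ s, F i x) (∑ i ∈ s, N i) := by
  classical
  induction s using Finset.induction_on with
  | empty => simpa using OrderGE.of_nonpos le_rfl
  | insert i s hi ih =>
    rw [Finset.forall_mem_insert] at hF h
    simp only [Finset.prod_insert hi, Finset.sum_insert hi]
    exact h.1.mul hY hF.1 (contDiffAt_prod hF.2) (ih hF.2 h.2)

theorem OrderGE.vfOp_of_eq_sum {Z : Rn n → Rn n} {c : Fin n → Rn n → ℝ} {r : ℤ}
    (hY : ∀ j, ContDiffAt ℝ ∞ (Y j) p) (hc : ∀ k, ContDiffAt ℝ ∞ (c k) p)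
    (hf : ContDiffAt ℝ ∞ f p) (hZ : Z =ᶠ[𝓝 p] fun x => ∑ k, c k x • Y k x)
    (hcN : ∀ k, OrderGE w Y p (c k) (w k - r)) (h : OrderGE w Y p f N) :
    OrderGE w Y p (vfOp Z f) (N - r) := by
  have hZf : vfOp Z f =ᶠ[𝓝 p] fun x => ∑ k, c k x * vfOp (Y k) f x := by
    filter_upwards [hZ] with x hx
    rw [← vfOp_sum_smul, vfOp, vfOp, hx]
  have hYf (k : Fin n) : ContDiffAt ℝ ∞ (vfOp (Y k) f) p := contDiffAt_vfOp (hY k) hf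
  refine (OrderGE.sum hY (fun k _ => (hc k).mul (hYf k)) fun k _ => ?_).congr hZf
  exact ((hcN k).mul hY (hc k) (hYf k) (h.apply_frame k)).mono (by omega)

theorem OrderGE.change_frame {X : Fin n → Rn n → Rn n} {c : Fin n → Fin n → Rn n → ℝ}
    (hY : ∀ j, ContDiffAt ℝ ∞ (Y j) p) (hc : ∀ j k, ContDiffAt ℝ ∞ (c j k) p)
    (hf : ContDiffAt ℝ ∞ f p) (hX : ∀ j, X j =ᶠ[𝓝 p] fun x => ∑ k, c j k x • Y k x)
    (hcN : ∀ j k, OrderGE w Y p (c j k) (w k - w j)) (h : OrderGE w Y p f N) :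
    OrderGE w X p f N := by
  have hXs (j : Fin n) : ContDiffAt ℝ ∞ (X j) p :=
    (ContDiffAt.sum fun k _ => (hc j k).smul (hY k)).congr_of_eventuallyEq (hX j)
  have shift (I : List (Fin n)) : OrderGE w Y p (vfSeqOp X I f) (N - seqWeight w I) := by
    induction I with
    | nil => simpa [seqWeight] using h
    | cons j I ih =>
      rw [seqWeight_cons]
      exact (ih.vfOp_of_eq_sum hY (hc j) (contDiffAt_vfSeqOp hXs hf I) (hX j) (hcN j)).mono
        (by omega)
  exact fun I hI => (orderGE_iff.1 (shift I)).1 (by omega)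

theorem contDiffAt_det {E ι : Type*} [NormedAddCommGroup E] [NormedSpace ℝ E] [Fintype ι]
    [DecidableEq ι] {M : E → Matrix ι ι ℝ} {m : WithTop ℕ∞} {p : E}
    (hM : ∀ k l, ContDiffAt ℝ m (fun x => M x k l) p) :
    ContDiffAt ℝ m (fun x => (M x).det) p := by
  simp only [Matrix.det_apply']
  exact ContDiffAt.sum fun σ _ => contDiffAt_const.mul (contDiffAt_prod fun i _ => hM (σ i) i)

theorem orderGE_det {ι : Type*} [Fintype ι] [DecidableEq ι] {M : Rn n → Matrix ι ι ℝ} {r u : ι → ℤ}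
    (hY : ∀ j, ContDiffAt ℝ ∞ (Y j) p) (hM : ∀ k l, ContDiffAt ℝ ∞ (fun x => M x k l) p)
    (hMN : ∀ k l, OrderGE w Y p (fun x => M x k l) (u l - r k)) :
    OrderGE w Y p (fun x => (M x).det) (∑ l, u l - ∑ k, r k) := by
  simp only [Matrix.det_apply']
  refine OrderGE.sum hY
    (fun σ _ => contDiffAt_const.mul (contDiffAt_prod fun i _ => hM (σ i) i)) fun σ _ => ?_
  have hσ : ∑ i, (u i - r (σ i)) = ∑ l, u l - ∑ k, r k := by
    rw [Finset.sum_sub_distrib, Equiv.sum_comp σ r]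
  exact hσ ▸ (OrderGE.prod hY (fun i _ => hM (σ i) i) fun i _ => hMN (σ i) i).const_mul _

theorem contDiffAt_adjugate {E ι : Type*} [NormedAddCommGroup E] [NormedSpace ℝ E] [Fintype ι]
    [DecidableEq ι] {M : E → Matrix ι ι ℝ} {m : WithTop ℕ∞} {p : E}
    (hM : ∀ k l, ContDiffAt ℝ m (fun x => M x k l) p) (i j : ι) :
    ContDiffAt ℝ m (fun x => (M x).adjugate i j) p := by
  simp only [Matrix.adjugate_apply]
  refine contDiffAt_det fun k l => ?_
  by_cases hk : k = j
  · simpa [hk] using contDiffAt_const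
  · simpa [Matrix.updateRow_ne hk] using hM k l

theorem orderGE_adjugate {ι : Type*} [Fintype ι] [DecidableEq ι] {M : Rn n → Matrix ι ι ℝ}
    {v : ι → ℤ}
    (hY : ∀ j, ContDiffAt ℝ ∞ (Y j) p) (hM : ∀ k l, ContDiffAt ℝ ∞ (fun x => M x k l) p)
    (hMN : ∀ k l, OrderGE w Y p (fun x => M x k l) (v l - v k)) (i j : ι) :
    OrderGE w Y p (fun x => (M x).adjugate i j) (v j - v i) := by
  have update_sum : ∑ l, v l - ∑ k, Function.update v j (v i) k = v j - v i := by
    rw [Finset.sum_update_of_mem (Finset.mem_univ j), Finset.sdiff_singleton_eq_erase,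
      ← Finset.add_sum_erase _ v (Finset.mem_univ j)]
    ring
  rw [← update_sum]
  simp only [Matrix.adjugate_apply]
  -- The cofactor is the determinant of `M` with the `j`-th row replaced by the `i`-th unit vector,
  -- whose entries have the orders of a row of weight `v i`.
  refine orderGE_det hY (fun k l => ?_) fun k l => ?_
  all_goals by_cases hk : k = j
  · simpa [hk] using contDiffAt_const
  · simpa [Matrix.updateRow_ne hk] using hM k l
  · subst hk
    by_cases hl : l = i
    · exact OrderGE.of_nonpos (by simp [hl])
    · simpa [Pi.single_apply, hl] using orderGE_zero
  · simpa [Matrix.updateRow_ne hk, hk] using hMN k l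

theorem exists_coordField_eq_sum_smul (hY : ∀ j, ContDiffAt ℝ ∞ (Y j) p)
    (hdet : (Matrix.of fun j k => Y j p k).det ≠ 0)
    (hYN : ∀ j k, OrderGE w Y p (fun x => Y j x k) (w k - w j)) :
    ∃ b : Fin n → Fin n → Rn n → ℝ, (∀ i j, ContDiffAt ℝ ∞ (b i j) p) ∧
      (∀ i j, OrderGE w Y p (b i j) (w j - w i)) ∧
      ∀ i, coordField i =ᶠ[𝓝 p] fun x => ∑ j, b i j x • Y j x := by
  set A : Rn n → Matrix (Fin n) (Fin n) ℝ := fun x => Matrix.of fun j k => Y j x k with hA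
  have smooth (k l : Fin n) : ContDiffAt ℝ ∞ (fun x => A x k l) p := contDiffAt_component (hY k) l
  have smooth_inv : ContDiffAt ℝ ∞ (fun x => (A x).det⁻¹) p := (contDiffAt_det smooth).inv hdet
  have smooth_adj := contDiffAt_adjugate smooth
  refine ⟨fun i j x => (A x).det⁻¹ * (A x).adjugate i j, fun i j => smooth_inv.mul (smooth_adj i j),
    fun i j => ?_, fun i => ?_⟩
  · have inv_order : OrderGE w Y p (fun x => (A x).det⁻¹) 0 := .of_nonpos le_rfl
    simpa using inv_order.mul hY smooth_inv (smooth_adj i j)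
      (orderGE_adjugate (v := fun i => (w i : ℤ)) hY smooth hYN i j)
  · filter_upwards [(contDiffAt_det smooth).continuousAt.eventually_ne hdet] with x hx
    have adj_mul (l : Fin n) :
        ∑ j, (A x).adjugate i j * Y j x l = if i = l then (A x).det else 0 := by
      simpa [Matrix.mul_apply, Matrix.one_apply, hA] using
        congrFun (congrFun (Matrix.adjugate_mul (A x)) i) l
    ext l
    simp [coordField, mul_assoc, ← Finset.mul_sum, adj_mul, hx, eq_comm]

end Order

/-! ### Privileged frames in coordinates -/

section Weight

variable {w : Fin n → ℕ} {Y : Fin n → Rn n → Rn n} {f : Rn n → ℝ} {N : ℤ}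

theorem weightGE_iff_orderGE (hf : ContDiffAt ℝ ∞ f 0) :
    WeightGE w f N ↔ OrderGE w coordField 0 f N := by
  constructor
  · intro h I hI
    have perm : I.Perm (indexList fun i => I.count i) := perm_indexList_iff.2 fun _ => rfl
    rw [(vfSeqOp_coordField_perm perm hf).self_of_nhds, ← partialDeriv_eq_vfSeqOp]
    refine h _ ?_
    rwa [← seqWeight_indexList, seqWeight, ← (perm.map w).sum_eq]
  · intro h α hα
    rw [partialDeriv_eq_vfSeqOp]
    exact h _ (by rwa [seqWeight_indexList])

theorem orderGE_coord (w : Fin n → ℕ) (k : Fin n) :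
    OrderGE w coordField 0 (fun x => x k) (w k) := by
  refine orderGE_iff.2 ⟨fun _ => rfl, fun i => ?_⟩
  rw [vfOp_coord]
  by_cases hi : i = k
  · exact OrderGE.of_nonpos (by simp [hi])
  · simpa [coordField, Pi.single_apply, Ne.symm hi] using orderGE_zero

/-- The components of `Y j` have weight at least `w k - w j`, that is, each `Y j` has weight at
least `-w j` as a differential operator. -/
def ComponentsWeightGE (w : Fin n → ℕ) (Y : Fin n → Rn n → Rn n) : Prop :=
  ∀ j k, WeightGE w (fun x => Y j x k) (w k - w j)

theorem componentsWeightGE_iff_orderGE (hY : ∀ j, ContDiffAt ℝ ∞ (Y j) 0) :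
    ComponentsWeightGE w Y ↔ ∀ j k, OrderGE w coordField 0 (fun x => Y j x k) (w k - w j) :=
  forall₂_congr fun j k => weightGE_iff_orderGE (contDiffAt_component (hY j) k)

theorem componentsWeightGE_iff_orderGE_coord (hY : ∀ j, ContDiffAt ℝ ∞ (Y j) 0)
    (hY0 : ∀ j, Y j 0 = EuclideanSpace.single j 1) :
    ComponentsWeightGE w Y ↔ ∀ k, OrderGE w Y 0 (fun x => x k) (w k) := by
  rw [componentsWeightGE_iff_orderGE hY]
  have smooth (j k : Fin n) : ContDiffAt ℝ ∞ (fun x => Y j x k) 0 := contDiffAt_component (hY j) k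
  constructor
  · refine fun h k => (orderGE_coord w k).change_frame contDiffAt_coordField smooth
      (contDiff_coord k).contDiffAt (fun j => .of_forall fun x => ?_) h
    exact (sum_smul_single (Y j x)).symm
  · intro h
    have order (j k : Fin n) : OrderGE w Y 0 (fun x => Y j x k) (w k - w j) := by
      rw [← vfOp_coord]
      exact (h k).apply_frame j
    have hdet : (Matrix.of fun j k => Y j 0 k).det ≠ 0 := by
      have : (Matrix.of fun j k => Y j 0 k) = 1 := by
        ext j k
        simp [hY0, Matrix.one_apply, eq_comm]
      simp [this]
    obtain ⟨b, hb, hbN, hcoord⟩ := exists_coordField_eq_sum_smul hY hdet order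
    exact fun j k => (order j k).change_frame hY hb (smooth j k) hcoord hbN

end Weight

/-! ### Weights of differential operators -/

section DiffOp

variable {w : Fin n → ℕ} {Y : Fin n → Rn n → Rn n} {Z : Rn n → Rn n}
  {a : (Fin n → ℕ) → Rn n → ℝ} {f u : Rn n → ℝ} {p : Rn n}

theorem WeightGE.orderGE_partialDeriv {N : ℤ} (hf : ContDiffAt ℝ ∞ f 0) (h : WeightGE w f N)
    (α : Fin n → ℕ) : OrderGE w coordField 0 (partialDeriv α f) (N - wlen w α) := by
  intro I hI
  rw [partialDeriv_eq_vfSeqOp, ← vfSeqOp_append]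
  refine (weightGE_iff_orderGE hf).1 h _ ?_
  rw [← seqWeight_indexList] at hI
  simp only [seqWeight, List.map_append, List.sum_append] at hI ⊢
  omega

theorem DiffOpHasWeight.orderGE_apply {U : Set (Rn n)} {P : (Rn n → ℝ) → Rn n → ℝ} {N M : ℤ}
    (hU : U ∈ 𝓝 0) (hP : DiffOpHasWeight w U P N) (hf : ContDiff ℝ ∞ f) (h : WeightGE w f M) :
    OrderGE w coordField 0 (P f) (N + M) := by
  obtain ⟨m, a, ⟨ha, hPa⟩, haN, -⟩ := hP
  have ha0 (α) (hα : α ∈ multiOrders n m) : ContDiffAt ℝ ∞ (a α) 0 := (ha α hα).contDiffAt hU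
  have hf' (α : Fin n → ℕ) := contDiffAt_partialDeriv (p := 0) hf.contDiffAt α
  have hPf : P f =ᶠ[𝓝 0] fun x => ∑ α ∈ multiOrders n m, a α x * partialDeriv α f x :=
    Filter.mem_of_superset hU fun x hx => hPa f hf.contDiffOn x hx
  refine (OrderGE.sum contDiffAt_coordField (fun α hα => (ha0 α hα).mul (hf' α))
    fun α hα => ?_).congr hPf
  exact (((weightGE_iff_orderGE (ha0 α hα)).1 (haN α hα)).mul contDiffAt_coordField (ha0 α hα)
    (hf' α) (h.orderGE_partialDeriv hf.contDiffAt α)).mono (by omega)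

theorem ComponentsWeightGE.of_diffOpHasWeight {U : Set (Rn n)} (hU : U ∈ 𝓝 0)
    (hY : ∀ j, ContDiffAt ℝ ∞ (Y j) 0)
    (h : ∀ j, DiffOpHasWeight w U (vfOp (Y j)) (-(w j : ℤ))) : ComponentsWeightGE w Y := by
  refine (componentsWeightGE_iff_orderGE hY).2 fun j k => ?_
  have coord := (weightGE_iff_orderGE (contDiff_coord k).contDiffAt).2 (orderGE_coord w k)
  rw [← vfOp_coord, sub_eq_neg_add]
  exact (h j).orderGE_apply hU (contDiff_coord k) coord

/-- The coefficients of `∑ a_γ ∂_k ∂^γ`. The case distinction is needed because the subtraction of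
multi-indices is truncated. -/
def shiftCoeff (k : Fin n) (a : (Fin n → ℕ) → Rn n → ℝ) (γ : Fin n → ℕ) : Rn n → ℝ :=
  if γ k = 0 then fun _ => 0 else a (γ - Pi.single k 1)

/-- The coefficients of `Z ∘ ∑ a_γ ∂^γ`. -/
def compCoeff (Z : Rn n → Rn n) (a : (Fin n → ℕ) → Rn n → ℝ) (γ : Fin n → ℕ) (x : Rn n) : ℝ :=
  vfOp Z (a γ) x + ∑ k, Z x k * shiftCoeff k a γ x

/-- The coefficients of the differential operator `Y_{i₁} ⋯ Y_{i_k}`. -/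
def frameCoeff (Y : Fin n → Rn n → Rn n) : List (Fin n) → (Fin n → ℕ) → Rn n → ℝ
  | [], γ => fun _ => if γ = 0 then 1 else 0
  | i :: I, γ => compCoeff (Y i) (frameCoeff Y I) γ

theorem shiftCoeff_add_single (k : Fin n) (a : (Fin n → ℕ) → Rn n → ℝ) (γ : Fin n → ℕ) :
    shiftCoeff k a (γ + Pi.single k 1) = a γ := by
  simp [shiftCoeff]

theorem shiftCoeff_eq_zero_or (k : Fin n) (a : (Fin n → ℕ) → Rn n → ℝ) (γ : Fin n → ℕ) :
    (shiftCoeff k a γ = fun _ => 0) ∨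
      ∃ γ', γ = γ' + Pi.single k 1 ∧ shiftCoeff k a γ = a γ' := by
  by_cases hγ : γ k = 0
  · exact .inl (if_pos hγ)
  · refine .inr ⟨γ - Pi.single k 1, (tsub_add_cancel_of_le ?_).symm, if_neg hγ⟩
    exact update_le_iff.2 ⟨Nat.one_le_iff_ne_zero.2 hγ, fun i _ => Nat.zero_le _⟩

theorem sum_add_single (γ : Fin n → ℕ) (k : Fin n) :
    ∑ i, (γ + Pi.single k 1 : Fin n → ℕ) i = ∑ i, γ i + 1 := by
  simp [Finset.sum_add_distrib]

theorem sum_multiOrders_add_single (k : Fin n) (a : (Fin n → ℕ) → Rn n → ℝ)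
    (G : (Fin n → ℕ) → ℝ) (m : ℕ) (x : Rn n) :
    ∑ γ ∈ multiOrders n m, a γ x * G (γ + Pi.single k 1) =
      ∑ γ ∈ multiOrders n (m + 1), shiftCoeff k a γ x * G γ := by
  refine Finset.sum_of_injOn (· + Pi.single k 1) (add_left_injective _).injOn
    (fun γ hγ => ?_) (fun γ hγ himage => ?_) fun γ _ => by rw [shiftCoeff_add_single]
  · have hγ := mem_multiOrders.1 hγ
    exact mem_multiOrders.2 (by rw [sum_add_single]; omega)
  · rcases shiftCoeff_eq_zero_or k a γ with h | ⟨γ', rfl, -⟩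
    · rw [h, zero_mul]
    · rw [mem_multiOrders, sum_add_single] at hγ
      exact absurd ⟨γ', mem_multiOrders.2 (by omega), rfl⟩ himage

theorem vfOp_sum_mul_partialDeriv (ha : ∀ γ, ContDiffAt ℝ ∞ (a γ) p) (hu : ContDiffAt ℝ ∞ u p)
    {m : ℕ} (ham : ∀ γ : Fin n → ℕ, m < ∑ i, γ i → a γ = fun _ => 0) :
    vfOp Z (fun x => ∑ γ ∈ multiOrders n m, a γ x * partialDeriv γ u x) =ᶠ[𝓝 p]
      fun x => ∑ γ ∈ multiOrders n (m + 1), compCoeff Z a γ x * partialDeriv γ u x := by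
  have hu' (γ : Fin n → ℕ) := contDiffAt_partialDeriv hu γ
  have leibniz := (Finset.eventually_all (multiOrders n m)).2 fun γ _ =>
    (vfOp_mul (ha γ) (hu' γ) Z).and (vfOp_partialDeriv hu Z γ)
  filter_upwards [vfOp_sum (s := multiOrders n m) (fun γ _ => (ha γ).mul (hu' γ)) Z, leibniz]
    with x hsum hx
  have low : ∑ γ ∈ multiOrders n m, vfOp Z (a γ) x * partialDeriv γ u x =
      ∑ γ ∈ multiOrders n (m + 1), vfOp Z (a γ) x * partialDeriv γ u x := by
    refine Finset.sum_subset (fun γ hγ => mem_multiOrders.2 ?_) fun γ _ hγ => ?_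
    · exact (mem_multiOrders.1 hγ).trans m.le_succ
    · rw [ham γ (not_le.1 fun h => hγ (mem_multiOrders.2 h)), vfOp_const, zero_mul]
  rw [hsum, Finset.sum_congr rfl fun γ hγ => (hx γ hγ).1.trans (by rw [(hx γ hγ).2])]
  simp only [compCoeff, add_mul, Finset.sum_add_distrib, Finset.sum_mul, Finset.mul_sum, low]
  congr 1
  rw [Finset.sum_comm, Finset.sum_comm (s := multiOrders n (m + 1))]
  refine Finset.sum_congr rfl fun k _ => ?_
  simpa only [mul_left_comm, mul_assoc] using
    sum_multiOrders_add_single k a (fun γ => Z x k * partialDeriv γ u x) m x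

theorem contDiffAt_shiftCoeff (ha : ∀ γ, ContDiffAt ℝ ∞ (a γ) p) (k : Fin n) (γ : Fin n → ℕ) :
    ContDiffAt ℝ ∞ (shiftCoeff k a γ) p := by
  rcases shiftCoeff_eq_zero_or k a γ with h | ⟨γ', -, h⟩
  · exact h ▸ contDiffAt_const
  · exact h ▸ ha γ'

theorem contDiffAt_frameCoeff (hY : ∀ j, ContDiffAt ℝ ∞ (Y j) p) (I : List (Fin n))
    (γ : Fin n → ℕ) : ContDiffAt ℝ ∞ (frameCoeff Y I γ) p := by
  induction I generalizing γ with
  | nil => exact contDiffAt_const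
  | cons i I ih =>
    exact (contDiffAt_vfOp (hY i) (ih γ)).add (ContDiffAt.sum fun k _ =>
      (contDiffAt_component (hY i) k).mul (contDiffAt_shiftCoeff ih k γ))

theorem frameCoeff_eq_zero {I : List (Fin n)} {γ : Fin n → ℕ} (h : I.length < ∑ i, γ i) :
    frameCoeff Y I γ = fun _ => 0 := by
  induction I generalizing γ with
  | nil =>
    have hγ : γ ≠ 0 := by
      rintro rfl
      simp at h
    simp only [frameCoeff, hγ, if_false]
  | cons i I ih =>
    rw [List.length_cons] at h
    have shift (k : Fin n) : shiftCoeff k (frameCoeff Y I) γ = fun _ => 0 := by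
      rcases shiftCoeff_eq_zero_or k (frameCoeff Y I) γ with hk | ⟨γ', rfl, hk⟩
      · exact hk
      · rw [sum_add_single] at h
        rw [hk, ih (by omega)]
    funext x
    simp only [frameCoeff, compCoeff, ih (γ := γ) (by omega), vfOp_const, shift, mul_zero,
      Finset.sum_const_zero, add_zero]

theorem vfSeqOp_eq_sum_frameCoeff (hY : ∀ j, ContDiffAt ℝ ∞ (Y j) p) (hu : ContDiffAt ℝ ∞ u p)
    (I : List (Fin n)) :
    vfSeqOp Y I u =ᶠ[𝓝 p]
      fun x => ∑ γ ∈ multiOrders n I.length, frameCoeff Y I γ x * partialDeriv γ u x := by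
  induction I with
  | nil =>
    have h0 : (0 : Fin n → ℕ) ∈ multiOrders n 0 := mem_multiOrders.2 (by simp)
    have hu0 : partialDeriv 0 u = u := by
      rw [partialDeriv_eq_vfSeqOp, indexList_zero, vfSeqOp_nil]
    exact .of_forall fun x => by simp [frameCoeff, h0, hu0]
  | cons i I ih =>
    exact (vfOp_congr ih (Y i)).trans (vfOp_sum_mul_partialDeriv (contDiffAt_frameCoeff hY I) hu
      fun γ hγ => frameCoeff_eq_zero hγ)

theorem ComponentsWeightGE.orderGE_frameCoeff (hY : ∀ j, ContDiffAt ℝ ∞ (Y j) 0)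
    (h : ComponentsWeightGE w Y) (I : List (Fin n)) (γ : Fin n → ℕ) :
    OrderGE w coordField 0 (frameCoeff Y I γ) (wlen w γ - seqWeight w I) := by
  have hord := (componentsWeightGE_iff_orderGE hY).1 h
  induction I generalizing γ with
  | nil =>
    by_cases hγ : γ = 0
    · exact OrderGE.of_nonpos (by simp [hγ, wlen])
    · simpa [frameCoeff, hγ] using orderGE_zero
  | cons i I ih =>
    have smooth := contDiffAt_frameCoeff hY I
    have smooth_comp := contDiffAt_component (hY i)
    have smooth_shift := contDiffAt_shiftCoeff smooth
    have shift (k : Fin n) : OrderGE w coordField 0 (shiftCoeff k (frameCoeff Y I) γ)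
        (wlen w γ - w k - seqWeight w I) := by
      rcases shiftCoeff_eq_zero_or k (frameCoeff Y I) γ with hk | ⟨γ', rfl, hk⟩
      · exact hk ▸ orderGE_zero
      · rw [hk, wlen_add_single]
        exact (ih γ').mono (by omega)
    rw [seqWeight_cons]
    refine OrderGE.add contDiffAt_coordField (contDiffAt_vfOp (hY i) (smooth γ))
      (ContDiffAt.sum fun k _ => (smooth_comp k).mul (smooth_shift k γ)) ?_
      (OrderGE.sum contDiffAt_coordField (fun k _ => (smooth_comp k).mul (smooth_shift k γ))
        fun k _ => ?_)
    · exact ((ih γ).vfOp_of_eq_sum contDiffAt_coordField smooth_comp (smooth γ)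
        (.of_forall fun x => (sum_smul_single (Y i x)).symm) (hord i)).mono (by omega)
    · exact ((hord i k).mul contDiffAt_coordField (smooth_comp k) (smooth_shift k γ)
        (shift k)).mono (by omega)

theorem frameCoeff_count_apply_zero (hY0 : ∀ j, Y j 0 = EuclideanSpace.single j 1)
    (I : List (Fin n)) : frameCoeff Y I (fun i => I.count i) 0 = 1 := by
  induction I with
  | nil => exact if_pos rfl
  | cons j I ih =>
    have count_cons : (fun i => (j :: I).count i) = (fun i => I.count i) + Pi.single j 1 := by
      funext i
      simp [List.count_cons, Pi.single_apply, @eq_comm _ j]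
    have degree : I.length < ∑ i, (j :: I).count i := by
      have := Multiset.sum_count_eq_card (s := Finset.univ) (m := (↑(j :: I) : Multiset (Fin n)))
        (by simp)
      simp only [Multiset.coe_count, Multiset.coe_card, List.length_cons] at this
      omega
    rw [frameCoeff, compCoeff, frameCoeff_eq_zero degree, vfOp_const, count_cons,
      Finset.sum_eq_single j (fun k _ hk => by simp [hY0, hk]) (by simp), shiftCoeff_add_single, ih]
    simp [hY0]

theorem ComponentsWeightGE.diffOpHasWeight_monomial {U : Set (Rn n)} (hU : IsOpen U)
    (h0 : (0 : Rn n) ∈ U) (hY : ∀ j, ContDiffOn ℝ ∞ (Y j) U)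
    (hY0 : ∀ j, Y j 0 = EuclideanSpace.single j 1) (h : ComponentsWeightGE w Y) (α : Fin n → ℕ) :
    DiffOpHasWeight w U (monomial (fun j => vfOp (Y j)) α) (-(wlen w α : ℤ)) := by
  have hYx (x) (hx : x ∈ U) (j : Fin n) := (hY j).contDiffAt (hU.mem_nhds hx)
  have smooth (x) (hx : x ∈ U) := contDiffAt_frameCoeff (hYx x hx) (indexList α)
  have weight (γ : Fin n → ℕ) :
      WeightGE w (frameCoeff Y (indexList α) γ) (-(wlen w α : ℤ) + wlen w γ) := by
    refine (weightGE_iff_orderGE (smooth 0 h0 γ)).2 ?_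
    exact (h.orderGE_frameCoeff (hYx 0 h0) _ γ).mono (by rw [seqWeight_indexList]; omega)
  have leading : frameCoeff Y (indexList α) α 0 = 1 := by
    simpa only [count_indexList] using frameCoeff_count_apply_zero hY0 (indexList α)
  refine ⟨(indexList α).length, frameCoeff Y (indexList α),
    ⟨fun γ _ x hx => (smooth x hx γ).contDiffWithinAt, fun u hu x hx => ?_⟩, fun γ _ => weight γ,
    α, ?_, weight α, 0, by simp [wlen], ?_⟩
  · rw [monomial_vfOp_eq_vfSeqOp]
    exact (vfSeqOp_eq_sum_frameCoeff (hYx x hx) (hu.contDiffAt (hU.mem_nhds hx)) _).self_of_nhds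
  · rw [mem_multiOrders, length_indexList]
  · rw [partialDeriv_eq_vfSeqOp, indexList_zero, vfSeqOp_nil, leading]
    exact one_ne_zero

end DiffOp

/-! ### Dilations and homogeneous functions -/

/-- `G` is homogeneous of degree `N` under the dilations with weights `w`. -/
def IsHomogeneous (w : Fin n → ℕ) (G : Rn n → ℝ) (N : ℤ) : Prop :=
  ∀ t : ℝ, t ≠ 0 → ∀ x, G (dilation w t x) = t ^ N * G x

/-- The monomial function `x^α`. -/
def coordMonomial (α : Fin n → ℕ) (x : Rn n) : ℝ := ∏ k, x k ^ α k

section Dilation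

variable {w : Fin n → ℕ} {f G : Rn n → ℝ} {N : ℤ} {t : ℝ}

theorem dilation_apply (w : Fin n → ℕ) (t : ℝ) (x : Rn n) (k : Fin n) :
    dilation w t x k = t ^ w k * x k := rfl

theorem dilation_one (w : Fin n → ℕ) (x : Rn n) : dilation w 1 x = x := by
  ext k
  simp [dilation_apply]

theorem dilation_zero_right (w : Fin n → ℕ) (t : ℝ) : dilation w t (0 : Rn n) = 0 := by
  ext k
  simp [dilation_apply]

theorem dilation_zero_left (hw : ∀ k, 1 ≤ w k) (x : Rn n) : dilation w 0 x = 0 := by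
  ext k
  simp [dilation_apply, Nat.one_le_iff_ne_zero.1 (hw k)]

/-- The dilation `δ_t`, `t ≠ 0`, as a linear automorphism. -/
def dilationEquiv (w : Fin n → ℕ) (ht : t ≠ 0) : Rn n ≃L[ℝ] Rn n :=
  LinearEquiv.toContinuousLinearEquiv
    { toFun := dilation w t
      invFun := dilation w t⁻¹
      map_add' := fun x y => by ext k; simp [dilation_apply, mul_add]
      map_smul' := fun c x => by ext k; simp [dilation_apply, mul_left_comm]
      left_inv := fun x => by ext k; simp [dilation_apply, ht]
      right_inv := fun x => by ext k; simp [dilation_apply, ht] }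

theorem pullback_dilation (Z : Rn n → Rn n) (ht : t ≠ 0) (x : Rn n) (k : Fin n) :
    VectorField.pullback ℝ (dilation w t) Z x k = (t ^ w k)⁻¹ * Z (dilation w t x) k := by
  have h : fderiv ℝ (dilation w t) x = dilationEquiv w ht := (dilationEquiv w ht).fderiv
  rw [VectorField.pullback, h, ContinuousLinearMap.inverse_equiv, ← inv_pow]
  rfl

theorem dilation_single (w : Fin n → ℕ) (t : ℝ) (i : Fin n) :
    dilation w t (EuclideanSpace.single i 1) = t ^ w i • EuclideanSpace.single i (1 : ℝ) := by
  ext k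
  rcases eq_or_ne k i with rfl | h
  · simp [dilation_apply]
  · simp [dilation_apply, h]

theorem vfOp_coordField_comp_dilation (ht : t ≠ 0) (f : Rn n → ℝ) (i : Fin n) :
    vfOp (coordField i) (fun y => f (dilation w t y)) =
      fun y => t ^ w i * vfOp (coordField i) f (dilation w t y) := by
  funext y
  change fderiv ℝ (f ∘ dilationEquiv w ht) y _ = _
  rw [(dilationEquiv w ht).comp_right_fderiv]
  change fderiv ℝ f (dilation w t y) (dilation w t (EuclideanSpace.single i 1)) = _
  rw [dilation_single, map_smul, smul_eq_mul]
  rfl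

theorem partialDeriv_comp_dilation (ht : t ≠ 0) (f : Rn n → ℝ) (α : Fin n → ℕ) :
    partialDeriv α (fun y => f (dilation w t y)) =
      fun y => t ^ wlen w α * partialDeriv α f (dilation w t y) := by
  rw [partialDeriv_eq_vfSeqOp, partialDeriv_eq_vfSeqOp, ← seqWeight_indexList]
  induction indexList α with
  | nil => simp [seqWeight]
  | cons i I ih =>
    simp only [vfSeqOp_cons, ih, vfOp_const_mul, vfOp_coordField_comp_dilation ht, seqWeight_cons,
      pow_add, mul_left_comm, mul_assoc]

theorem partialDeriv_const_mul (α : Fin n → ℕ) (c : ℝ) (f : Rn n → ℝ) :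
    partialDeriv α (fun x => c * f x) = fun x => c * partialDeriv α f x := by
  rw [partialDeriv_eq_vfSeqOp, partialDeriv_eq_vfSeqOp, vfSeqOp_const_mul]

theorem IsHomogeneous.partialDeriv_apply_zero (hG : IsHomogeneous w G N) {α : Fin n → ℕ}
    (hα : (wlen w α : ℤ) ≠ N) : partialDeriv α G 0 = 0 := by
  have h2 : (fun y => G (dilation w 2 y)) = fun y => 2 ^ N * G y := funext (hG 2 two_ne_zero)
  have h := congrFun (partialDeriv_comp_dilation (w := w) two_ne_zero G α) 0
  rw [h2, partialDeriv_const_mul, dilation_zero_right, ← zpow_natCast] at h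
  exact (mul_eq_mul_right_iff.1 h).resolve_left fun h =>
    hα (zpow_right_injective₀ two_pos (by norm_num) h).symm

theorem hasDerivAt_comp_dilation (w : Fin n → ℕ) (x : Rn n) (s : ℝ)
    (hf : DifferentiableAt ℝ f (dilation w s x)) :
    HasDerivAt (fun s => f (dilation w s x))
      (∑ k, (w k * s ^ (w k - 1) * x k) * vfOp (coordField k) f (dilation w s x)) s := by
  have hδ : HasDerivAt (fun s => dilation w s x)
      (WithLp.toLp 2 fun k => w k * s ^ (w k - 1) * x k) s :=
    (PiLp.hasFDerivAt_toLp (𝕜 := ℝ) (E := fun _ : Fin n => ℝ) 2 _).comp_hasDerivAt s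
      (hasDerivAt_pi.2 fun k => (hasDerivAt_pow (w k) s).mul_const (x k))
  exact (hf.hasFDerivAt.comp_hasDerivAt s hδ).congr_deriv
    (vfOp_eq_sum (fun _ => WithLp.toLp 2 fun k => w k * s ^ (w k - 1) * x k) f _)

theorem IsHomogeneous.euler (hG : IsHomogeneous w G N) {x : Rn n} (hx : DifferentiableAt ℝ G x) :
    ∑ k, w k * x k * vfOp (coordField k) G x = N * G x := by
  have h₁ := hasDerivAt_comp_dilation w x 1 (f := G) (by rwa [dilation_one])
  have h₂ : HasDerivAt (fun s => G (dilation w s x)) (N * G x) 1 := by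
    have := (hasDerivAt_zpow N (1 : ℝ) (.inl one_ne_zero)).mul_const (G x)
    rw [one_zpow, mul_one] at this
    refine this.congr_of_eventuallyEq ?_
    filter_upwards [eventually_ne_nhds one_ne_zero] with s hs using hG s hs x
  simpa [dilation_one] using h₁.unique h₂

theorem contDiff_coordMonomial (α : Fin n → ℕ) : ContDiff ℝ ∞ (coordMonomial α) :=
  contDiff_prod fun k _ => (contDiff_coord k).pow (α k)

theorem isHomogeneous_coordMonomial (w α : Fin n → ℕ) :
    IsHomogeneous w (coordMonomial α) (wlen w α) := by
  intro t _ x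
  simp only [coordMonomial, dilation_apply, mul_pow, Finset.prod_mul_distrib, ← pow_mul,
    Finset.prod_pow_eq_pow_sum, zpow_natCast, wlen]

theorem wlen_single_left (k : Fin n) (α : Fin n → ℕ) : wlen (Pi.single k 1) α = α k := by
  simp [wlen, Pi.single_apply]

theorem vfOp_coordField_coordMonomial (α : Fin n → ℕ) (i : Fin n) :
    vfOp (coordField i) (coordMonomial (α + Pi.single i 1)) =
      fun x => (α i + 1) * coordMonomial α x := by
  have factor : coordMonomial (α + Pi.single i 1) = fun x => x i * coordMonomial α x := by
    funext x
    simp only [coordMonomial, Pi.add_apply, pow_add, Finset.prod_mul_distrib]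
    simp [Pi.single_apply, pow_ite, mul_comm]
  funext x
  -- Euler's identity for the dilations of the `i`-th coordinate alone.
  have euler : x i * vfOp (coordField i) (coordMonomial α) x = α i * coordMonomial α x := by
    simpa [wlen_single_left, Pi.single_apply] using
      (isHomogeneous_coordMonomial (Pi.single i 1) α).euler
        ((contDiff_coordMonomial α).differentiable (by simp) x)
  rw [factor, (vfOp_mul (contDiff_coord i).contDiffAt (contDiff_coordMonomial α).contDiffAt
    (coordField i)).self_of_nhds]
  simp only [vfOp_coord, coordField, PiLp.single_apply, if_true] at euler ⊢
  linear_combination euler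

theorem partialDeriv_coordMonomial_self_ne_zero (α : Fin n → ℕ) :
    partialDeriv α (coordMonomial α) 0 ≠ 0 := by
  have h (I : List (Fin n)) (α : Fin n → ℕ) (hI : I.Perm (indexList α)) :
      vfSeqOp coordField I (coordMonomial α) 0 ≠ 0 := by
    induction I using List.reverseRecOn generalizing α with
    | nil =>
      have hα : ∀ i, α i = 0 := fun i => (perm_indexList_iff.1 hI i).symm
      simp [coordMonomial, hα]
    | append_singleton I i ih =>
      have hα : α = (fun k => I.count k) + Pi.single i 1 := by
        funext k
        simp [← perm_indexList_iff.1 hI k, List.count_singleton, Pi.single_apply, @eq_comm _ i]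
      rw [hα, vfSeqOp_append, vfSeqOp_cons, vfSeqOp_nil, vfOp_coordField_coordMonomial,
        vfSeqOp_const_mul]
      exact mul_ne_zero (by positivity) (ih _ (perm_indexList_iff.2 fun _ => rfl))
  rw [partialDeriv_eq_vfSeqOp]
  exact h _ α (List.Perm.refl _)

theorem partialDeriv_coordMonomial_of_ne {α β : Fin n → ℕ} (h : β ≠ α) :
    partialDeriv β (coordMonomial α) 0 = 0 := by
  obtain ⟨k, hk⟩ := Function.ne_iff.1 h
  -- Compare degrees under the dilations of the `k`-th coordinate alone.
  refine (isHomogeneous_coordMonomial (Pi.single k 1) α).partialDeriv_apply_zero ?_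
  simpa only [wlen_single_left, ne_eq, Nat.cast_inj] using hk

theorem partialDeriv_sub (hf : ContDiffAt ℝ ∞ f 0) (hG : ContDiffAt ℝ ∞ G 0) (α : Fin n → ℕ) :
    partialDeriv α (fun x => f x - G x) 0 = partialDeriv α f 0 - partialDeriv α G 0 := by
  have hneg : ContDiffAt ℝ ∞ (fun x => -1 * G x) 0 := contDiffAt_const.mul hG
  have h := (vfSeqOp_add contDiffAt_coordField hf hneg (indexList α)).self_of_nhds
  rw [vfSeqOp_const_mul] at h
  simpa only [partialDeriv_eq_vfSeqOp, neg_one_mul, ← sub_eq_add_neg] using h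

theorem sum_le_wlen (hw : ∀ k, 1 ≤ w k) (α : Fin n → ℕ) : ∑ k, α k ≤ wlen w α :=
  Finset.sum_le_sum fun k _ => Nat.le_mul_of_pos_left _ (hw k)

theorem WeightGE.exists_isHomogeneous (hw : ∀ k, 1 ≤ w k) (hf : ContDiffAt ℝ ∞ f 0)
    (h : WeightGE w f N) : ∃ G : Rn n → ℝ, ContDiff ℝ ∞ G ∧ IsHomogeneous w G N ∧
      WeightGE w (fun x => f x - G x) (N + 1) := by
  set s := (multiOrders n N.toNat).filter fun α => (wlen w α : ℤ) = N
  set c : (Fin n → ℕ) → ℝ := fun α => partialDeriv α f 0 / partialDeriv α (coordMonomial α) 0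
  have smooth (α : Fin n → ℕ) : ContDiff ℝ ∞ fun x => c α * coordMonomial α x :=
    contDiff_const.mul (contDiff_coordMonomial α)
  have smooth_sum : ContDiff ℝ ∞ fun x => ∑ α ∈ s, c α * coordMonomial α x :=
    ContDiff.sum fun α _ => smooth α
  have hom : IsHomogeneous w (fun x => ∑ α ∈ s, c α * coordMonomial α x) N := by
    intro t ht x
    rw [Finset.mul_sum]
    refine Finset.sum_congr rfl fun α hα => ?_
    rw [isHomogeneous_coordMonomial w α t ht x, (Finset.mem_filter.1 hα).2, mul_left_comm]
  refine ⟨_, smooth_sum, hom, fun β hβ => ?_⟩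
  rw [partialDeriv_sub hf smooth_sum.contDiffAt]
  rcases (Int.lt_add_one_iff.1 hβ).lt_or_eq with hlt | heq
  · rw [h β hlt, hom.partialDeriv_apply_zero hlt.ne, sub_zero]
  · have hβs : β ∈ s := by
      have := sum_le_wlen hw β
      exact Finset.mem_filter.2 ⟨mem_multiOrders.2 (by omega), heq⟩
    have derivs (α : Fin n → ℕ) : vfSeqOp coordField (indexList β)
        (fun x => c α * coordMonomial α x) 0 = if α = β then partialDeriv β f 0 else 0 := by
      simp only [vfSeqOp_const_mul, ← partialDeriv_eq_vfSeqOp]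
      split_ifs with hα
      · rw [hα, div_mul_cancel₀ _ (partialDeriv_coordMonomial_self_ne_zero β)]
      · rw [partialDeriv_coordMonomial_of_ne (Ne.symm hα), mul_zero]
    rw [partialDeriv_eq_vfSeqOp (f := fun x => ∑ α ∈ s, c α * coordMonomial α x),
      (vfSeqOp_sum contDiffAt_coordField (fun α _ => (smooth α).contDiffAt) _).self_of_nhds]
    simp [derivs, hβs]

end Dilation

/-! ### The Taylor estimate -/

section Taylor

open Filter Asymptotics

variable {w : Fin n → ℕ} {f : Rn n → ℝ} {K : Set (Rn n)}

theorem tendsto_dilation (hw : ∀ k, 1 ≤ w k) (hK : IsCompact K) :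
    Tendsto (fun q : ℝ × Rn n => dilation w q.1 q.2) (𝓝 0 ×ˢ 𝓟 K) (𝓝 0) := by
  have hδ : Continuous fun q : ℝ × Rn n => dilation w q.1 q.2 := by
    unfold dilation
    fun_prop
  have h : Set.MapsTo (fun q : ℝ × Rn n => dilation w q.1 q.2) ({0} ×ˢ K) {0} := by
    rintro ⟨t, x⟩ ⟨rfl, _⟩
    exact dilation_zero_left hw x
  have lim := hδ.tendsto_nhdsSet h
  rw [isCompact_singleton.nhdsSet_prod_eq hK, nhdsSet_singleton, nhdsSet_singleton] at lim
  exact lim.mono_left (prod_mono le_rfl principal_le_nhdsSet)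

theorem isBigO_pow_succ_of_hasDerivAt {X : Type*} {K : Set X} {F F' : ℝ → X → ℝ} {p : ℕ}
    (h0 : ∀ x ∈ K, F 0 x = 0)
    (hF : ∀ᶠ q : ℝ × X in 𝓝 0 ×ˢ 𝓟 K, HasDerivAt (F · q.2) (F' q.1 q.2) q.1)
    (hF' : (fun q : ℝ × X => F' q.1 q.2) =O[𝓝 0 ×ˢ 𝓟 K] fun q => q.1 ^ p) :
    (fun q : ℝ × X => F q.1 q.2) =O[𝓝 0 ×ˢ 𝓟 K] fun q => q.1 ^ (p + 1) := by
  obtain ⟨B, hB0, hB⟩ := hF'.exists_nonneg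
  obtain ⟨ε, hε, h⟩ := Metric.eventually_nhds_iff_ball.1
    (eventually_prod_principal_iff.1 (hF.and hB.bound))
  simp only [mem_ball_zero_iff, Real.norm_eq_abs, abs_pow] at h
  refine IsBigO.of_bound B (eventually_prod_principal_iff.2 ?_)
  filter_upwards [Metric.ball_mem_nhds 0 hε] with s hs x hx
  have hs' : |s| < ε := by simpa using hs
  have h_le {r : ℝ} (hr : r ∈ Set.Icc (-|s|) |s|) : |r| ≤ |s| := abs_le.2 hr
  have mvt := (convex_Icc (-|s|) |s|).norm_image_sub_le_of_norm_hasDerivWithin_le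
    (fun r hr => (h r ((h_le hr).trans_lt hs') x hx).1.hasDerivWithinAt)
    (fun r hr => (h r ((h_le hr).trans_lt hs') x hx).2.trans
      (mul_le_mul_of_nonneg_left (pow_le_pow_left₀ (abs_nonneg r) (h_le hr) p) hB0))
    (x := 0) (y := s) (by simp) ⟨neg_abs_le s, le_abs_self s⟩
  simpa only [h0 x hx, sub_zero, mul_assoc, Real.norm_eq_abs, ← pow_succ, abs_pow] using mvt

theorem isBigO_pow_pow_of_le {m p : ℕ} (h : p ≤ m) :
    (fun s : ℝ => s ^ m) =O[𝓝 0] fun s => s ^ p := by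
  simpa only [pow_sub_mul_pow _ h, one_mul] using
    (((continuous_pow (m - p)).tendsto (0 : ℝ)).isBigO_one ℝ).mul (isBigO_refl (· ^ p) (𝓝 0))

theorem OrderGE.isBigO_comp_dilation (hw : ∀ k, 1 ≤ w k) (hK : IsCompact K) {N : ℕ}
    (hf : ContDiffAt ℝ ∞ f 0) (h : OrderGE w coordField 0 f N) :
    (fun q : ℝ × Rn n => f (dilation w q.1 q.2)) =O[𝓝 0 ×ˢ 𝓟 K] fun q => q.1 ^ N := by
  have hδ := tendsto_dilation hw hK
  induction N using Nat.strong_induction_on generalizing f with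
  | _ N ih =>
  rcases N with - | p
  · simp only [pow_zero]
    exact (hf.continuousAt.tendsto.comp hδ).isBigO_one ℝ
  · refine isBigO_pow_succ_of_hasDerivAt (F := fun s x => f (dilation w s x))
      (F' := fun s x => ∑ k, w k * s ^ (w k - 1) * x k * vfOp (coordField k) f (dilation w s x))
      (fun x _ => ?_) ((hδ.eventually (eventually_differentiableAt hf)).mono fun q hq =>
        hasDerivAt_comp_dilation w q.2 q.1 hq) ?_
    · simpa only [dilation_zero_left hw] using (orderGE_iff.1 h).1 (by positivity)
    · refine IsBigO.fun_sum fun k _ => ?_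
      have hwk := hw k
      have coord : (fun q : ℝ × Rn n => w k * q.1 ^ (w k - 1) * q.2 k) =O[𝓝 0 ×ˢ 𝓟 K]
          fun q => q.1 ^ (w k - 1) := by
        have bounded : (fun q : ℝ × Rn n => q.2 k) =O[𝓝 0 ×ˢ 𝓟 K] fun _ => (1 : ℝ) :=
          ((contDiff_coord k).continuous.continuousOn.isBigO_principal hK (by simp)).comp_tendsto
            tendsto_snd
        have power := isBigO_refl (fun q : ℝ × Rn n => q.1 ^ (w k - 1)) (𝓝 0 ×ˢ 𝓟 K)
        simpa only [mul_one] using (power.const_mul_left (w k : ℝ)).mul bounded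
      have deriv := ih _ (by omega) (contDiffAt_vfOp (contDiffAt_coordField k) hf)
        (h.apply_frame k).toNat
      have exponent : p ≤ w k - 1 + ((p + 1 : ℕ) - w k : ℤ).toNat := by omega
      refine (coord.mul deriv).trans ?_
      simp only [← pow_add]
      exact (isBigO_pow_pow_of_le exponent).comp_tendsto tendsto_fst

theorem OrderGE.isBigO_zpow_comp_dilation (hw : ∀ k, 1 ≤ w k) (hK : IsCompact K) {N : ℤ}
    (hf : ContDiffAt ℝ ∞ f 0) (h : OrderGE w coordField 0 f N) :
    (fun q : ℝ × Rn n => f (dilation w q.1 q.2)) =O[𝓝[≠] 0 ×ˢ 𝓟 K] fun q => q.1 ^ N := by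
  obtain ⟨m, hm⟩ := Int.eq_ofNat_of_zero_le (sub_nonneg.2 N.self_le_toNat)
  have pow_toNat : (fun s : ℝ => s ^ N.toNat) =O[𝓝[≠] 0] fun s => s ^ N := by
    have bounded : (fun s : ℝ => s ^ m) =O[𝓝[≠] 0] fun _ => (1 : ℝ) :=
      (((continuous_pow m).tendsto (0 : ℝ)).isBigO_one ℝ).mono nhdsWithin_le_nhds
    refine (bounded.mul (isBigO_refl (· ^ N) _)).congr' ?_ (.of_forall fun s => one_mul _)
    filter_upwards [self_mem_nhdsWithin] with s hs
    rw [← zpow_natCast, ← zpow_natCast, ← zpow_add₀ hs, ← hm, Int.ofNat_toNat, sub_add_cancel]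
  exact ((h.toNat.isBigO_comp_dilation hw hK hf).mono (prod_mono nhdsWithin_le_nhds le_rfl)).trans
    (pow_toNat.comp_tendsto tendsto_fst)

end Taylor

/-! ### Homogeneous models -/

section Model

open Filter Asymptotics

variable {w : Fin n → ℕ} {U : Set (Rn n)} {Y : Rn n → Rn n} {d : ℕ}

theorem rescaled_pullback_apply (Y : Rn n → Rn n) (d : ℕ) {t : ℝ} (ht : t ≠ 0) (y : Rn n)
    (k : Fin n) : (t ^ d • VectorField.pullback ℝ (dilation w t) Y y) k =
      t ^ (d - w k : ℤ) * Y (dilation w t y) k := by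
  rw [PiLp.smul_apply, pullback_dilation Y ht, smul_eq_mul, ← mul_assoc, zpow_sub₀ ht,
    zpow_natCast, zpow_natCast, div_eq_mul_inv]

theorem vfHomogeneous_iff {Z : Rn n → Rn n} :
    VFHomogeneous w Z (-(d : ℤ)) ↔ ∀ k, IsHomogeneous w (fun x => Z x k) (w k - d) := by
  have component {t : ℝ} (ht : t ≠ 0) (x : Rn n) (k : Fin n) :
      VectorField.pullback ℝ (dilation w t) Z x k = (t ^ (-(d : ℤ)) • Z x) k ↔
        Z (dilation w t x) k = t ^ (w k - d : ℤ) * Z x k := by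
    rw [pullback_dilation Z ht, PiLp.smul_apply, smul_eq_mul,
      inv_mul_eq_iff_eq_mul₀ (pow_ne_zero _ ht), sub_eq_add_neg, zpow_add₀ ht, zpow_natCast,
      mul_assoc]
  exact ⟨fun h k t ht x => (component ht x k).1 (by rw [h t ht x]),
    fun h t ht x => PiLp.ext fun k => (component ht x k).2 (h k t ht x)⟩

theorem partialDeriv_rescaled_sub {Z : Rn n → Rn n} (Y : Rn n → Rn n)
    (hZ : VFHomogeneous w Z (-(d : ℤ))) {t : ℝ} (ht : t ≠ 0) (k : Fin n) (α : Fin n → ℕ) :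
    partialDeriv α (fun y => (t ^ d • VectorField.pullback ℝ (dilation w t) Y y - Z y) k) =
      fun y => t ^ (d - w k + wlen w α : ℤ) *
        partialDeriv α (fun x => Y x k - Z x k) (dilation w t y) := by
  have factor (y : Rn n) : (t ^ d • VectorField.pullback ℝ (dilation w t) Y y - Z y) k =
      t ^ (d - w k : ℤ) * (Y (dilation w t y) k - Z (dilation w t y) k) := by
    have hZk : Z (dilation w t y) k = t ^ (w k - d : ℤ) * Z y k := vfHomogeneous_iff.1 hZ k t ht y
    rw [PiLp.sub_apply, rescaled_pullback_apply Y d ht, mul_sub, hZk, ← mul_assoc, ← zpow_add₀ ht,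
      sub_add_sub_cancel, sub_self, zpow_zero, one_mul]
  simp only [factor]
  rw [partialDeriv_const_mul, partialDeriv_comp_dilation ht (fun x => Y x k - Z x k)]
  simp only [zpow_add₀ ht _ (wlen w α : ℤ), zpow_natCast, mul_assoc]

theorem hasHomogeneousModel_of_weightGE (hw : ∀ k, 1 ≤ w k) (hY : ContDiffAt ℝ ∞ Y 0)
    (h : ∀ k, WeightGE w (fun x => Y x k) (w k - d)) : HasHomogeneousModel w U Y d := by
  have hYk := contDiffAt_component hY
  choose G smooth hom rem using fun k => (h k).exists_isHomogeneous hw (hYk k)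
  have homZ : VFHomogeneous w (fun x => WithLp.toLp 2 fun k => G k x) (-(d : ℤ)) :=
    vfHomogeneous_iff.2 hom
  refine ⟨_, contDiff_euclidean.2 smooth, homZ, fun K hK _ α k => ?_⟩
  have smooth_rem : ContDiffAt ℝ ∞ (fun x => Y x k - G k x) 0 := (hYk k).sub (smooth k).contDiffAt
  have taylor := ((rem k).orderGE_partialDeriv smooth_rem α).isBigO_zpow_comp_dilation hw hK
    (contDiffAt_partialDeriv smooth_rem α)
  obtain ⟨C, hC⟩ := taylor.bound
  refine ⟨C, ?_⟩
  filter_upwards [eventually_prod_principal_iff.1 hC, self_mem_nhdsWithin] with t bound ht x hx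
  rw [partialDeriv_rescaled_sub Y homZ ht, abs_mul]
  calc _ ≤ |t ^ (d - w k + wlen w α : ℤ)| * (C * |t ^ (w k - d + 1 - wlen w α : ℤ)|) :=
        mul_le_mul_of_nonneg_left (bound x hx) (abs_nonneg _)
    _ = C * |t| := by
        rw [mul_left_comm, ← abs_mul, ← zpow_add₀ ht]
        ring_nf
        simp

theorem HasHomogeneousModel.weightGE (h0 : 0 ∈ U) (hY : ContDiffAt ℝ ∞ Y 0)
    (h : HasHomogeneousModel w U Y d) (k : Fin n) : WeightGE w (fun x => Y x k) (w k - d) := by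
  obtain ⟨Z, hZ, homZ, hO⟩ := h
  intro α hα
  have model_deriv : partialDeriv α (fun x => Z x k) 0 = 0 :=
    (vfHomogeneous_iff.1 homZ k).partialDeriv_apply_zero hα.ne
  obtain ⟨C, hC⟩ := hO {0} isCompact_singleton (Set.singleton_subset_iff.2 h0) α k
  have small : ∀ᶠ t in 𝓝[≠] (0 : ℝ), |partialDeriv α (fun x => Y x k - Z x k) 0| ≤ C * |t| := by
    filter_upwards [hC, self_mem_nhdsWithin, nhdsWithin_le_nhds (Metric.ball_mem_nhds 0 one_pos)]
      with t ht t_ne t_lt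
    have one_le : 1 ≤ |t ^ (d - w k + wlen w α : ℤ)| := by
      rw [abs_zpow]
      exact one_le_zpow_of_nonpos₀ (abs_pos.2 t_ne) (mem_ball_zero_iff.1 t_lt).le (by omega)
    have bound := ht 0 rfl
    simp only [partialDeriv_rescaled_sub Y homZ t_ne, dilation_zero_right, abs_mul] at bound
    exact (le_mul_of_one_le_left (abs_nonneg _) one_le).trans bound
  have lim : Tendsto (fun t : ℝ => C * |t|) (𝓝[≠] 0) (𝓝 0) := by
    have : Continuous fun t : ℝ => C * |t| := by fun_prop
    simpa using (this.tendsto 0).mono_left nhdsWithin_le_nhds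
  have := abs_nonpos_iff.1 (ge_of_tendsto lim small)
  rwa [partialDeriv_sub (contDiffAt_component hY k) (contDiffAt_component hZ.contDiffAt k),
    model_deriv, sub_zero] at this

theorem hasHomogeneousModel_iff (h0 : 0 ∈ U) (hw : ∀ k, 1 ≤ w k) (hY : ContDiffAt ℝ ∞ Y 0) :
    HasHomogeneousModel w U Y d ↔ ∀ k, WeightGE w (fun x => Y x k) (w k - d) :=
  ⟨fun h => h.weightGE h0 hY, hasHomogeneousModel_of_weightGE hw hY⟩

end Model

/-! ### Passage to coordinates -/

section Transport

variable {M : Type*} [TopologicalSpace M] [ChartedSpace (Rn n) M]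
  {φ : OpenPartialHomeomorph M (Rn n)}

theorem mvfOp_eq_vfOp (hφ : φ ∈ IsManifold.maximalAtlas (𝓡 n) ∞ M)
    (X : (x : M) → TangentSpace (𝓡 n) x) {f : M → ℝ} {g : Rn n → ℝ} {p : M} (hp : p ∈ φ.source)
    (hg : DifferentiableAt ℝ g (φ p)) (hfg : ∀ q ∈ φ.source, f q = g (φ q)) :
    mvfOp X f p = vfOp (coordVF φ X) g (φ p) := by
  have hφp : MDifferentiableAt (𝓡 n) (𝓡 n) φ p :=
    ((contMDiffOn_of_mem_maximalAtlas hφ).contMDiffAt (φ.open_source.mem_nhds hp)).mdifferentiableAt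
      (by simp)
  have local_eq : f =ᶠ[𝓝 p] g ∘ φ := by
    filter_upwards [φ.open_source.mem_nhds hp] with q hq using hfg q hq
  rw [mvfOp, local_eq.mfderiv_eq, mfderiv_comp p hg.mdifferentiableAt hφp, mfderiv_eq_fderiv, vfOp,
    coordVF, φ.left_inv hp]
  rfl

variable [IsManifold (𝓡 n) ∞ M]

theorem CarnotStructure.rank_step (C : CarnotStructure n M) (a : M) : C.rank C.step = n := by
  obtain ⟨W, -, haW, Y, -, hY⟩ := C.isSubbundle C.step C.one_le_step le_rfl a
  obtain ⟨independent, span_eq⟩ := hY a haW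
  have card := finrank_span_eq_card independent
  rw [span_eq, C.top a, finrank_top, Fintype.card_fin] at card
  exact card.symm.trans (finrank_euclideanSpace_fin (𝕜 := ℝ))

theorem CarnotStructure.one_le_weight (C : CarnotStructure n M) (a : M) (j : Fin n) :
    1 ≤ C.weight j := by
  have nonempty : {v : ℕ | 1 ≤ v ∧ v ≤ C.step ∧ (j : ℕ) + 1 ≤ C.rank v}.Nonempty :=
    ⟨C.step, C.one_le_step, le_rfl, by rw [C.rank_step a]; exact j.isLt⟩
  exact (Nat.sInf_mem nonempty).1

theorem contDiffOn_coordVF (hφ : φ ∈ IsManifold.maximalAtlas (𝓡 n) ∞ M)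
    {X : (x : M) → TangentSpace (𝓡 n) x} (hX : SmoothVFOn X φ.source) :
    ContDiffOn ℝ ∞ (coordVF φ X) φ.target := by
  have section_smooth : ContMDiffOn (𝓡 n) (𝓡 n).tangent ∞
      (fun u => (⟨φ.symm u, X (φ.symm u)⟩ : TangentBundle (𝓡 n) M)) φ.target :=
    hX.comp (contMDiffOn_symm_of_mem_maximalAtlas hφ) fun u hu => φ.map_target hu
  have : IsManifold (𝓡 n) 1 M := IsManifold.of_le (n := ∞) (by simp)
  have tangent_smooth := ((contMDiffOn_of_mem_maximalAtlas hφ).contMDiffOn_tangentMapWithin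
    (m := ∞) (by simp) φ.open_source.uniqueMDiffOn).comp section_smooth fun u hu => φ.map_target hu
  intro u hu
  refine contMDiffWithinAt_vectorSpace_iff_contDiffWithinAt.1
    ((tangent_smooth u hu).congr_of_mem (fun v hv => ?_) hu)
  simp only [Function.comp_apply, tangentMapWithin, coordVF]
  rw [mfderivWithin_of_isOpen φ.open_source (φ.map_target hv), φ.right_inv hv]

theorem seqOp_eq_vfSeqOp (hφ : φ ∈ IsManifold.maximalAtlas (𝓡 n) ∞ M)
    {X : Fin n → (x : M) → TangentSpace (𝓡 n) x} (hX : ∀ j, SmoothVFOn (X j) φ.source)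
    {g : Rn n → ℝ} (hg : ContDiffOn ℝ ∞ g φ.target) (I : List (Fin n)) :
    ∀ p ∈ φ.source, seqOp X I (fun q => g (φ q)) p =
      vfSeqOp (fun i => coordVF φ (X i)) I g (φ p) := by
  induction I with
  | nil => exact fun _ _ => rfl
  | cons i I ih =>
    intro p hp
    have target_nhds : φ.target ∈ 𝓝 (φ p) := φ.open_target.mem_nhds (φ.map_source hp)
    have smooth := contDiffAt_vfSeqOp
      (fun j => (contDiffOn_coordVF hφ (hX j)).contDiffAt target_nhds) (hg.contDiffAt target_nhds) I
    exact mvfOp_eq_vfOp hφ (X i) hp (smooth.differentiableAt (by simp)) ih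

theorem isPrivileged_iff_orderGE {a : M} (hφ : IsCenteredChart φ a) (w : Fin n → ℕ)
    {X : Fin n → (x : M) → TangentSpace (𝓡 n) x} (hX : ∀ j, SmoothVFOn (X j) φ.source) :
    IsPrivileged w φ a X ↔ LinearlyAdapted φ X ∧
      ∀ k, OrderGE w (fun j => coordVF φ (X j)) 0 (fun x => x k) (w k) := by
  have coords (k : Fin n) (I : List (Fin n)) : seqOp X I (fun p => φ p k) a =
      vfSeqOp (fun i => coordVF φ (X i)) I (fun x => x k) 0 := by
    rw [seqOp_eq_vfSeqOp hφ.mem_maximalAtlas hX (contDiff_coord k).contDiffOn I a hφ.mem_source,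
      hφ.map_eq_zero]
  refine and_congr_right fun hlin => forall_congr' fun k => ?_
  simp only [HasOrder, OrderGE, coords, Nat.cast_lt, and_iff_left_iff_imp]
  exact fun _ => ⟨[k], by simp [seqWeight], by simp [vfOp_coord, hlin k]⟩

end Transport

end Carnot

end

theorem theorem5p1_general {n : ℕ} {M : Type*} [TopologicalSpace M] [ChartedSpace (Carnot.Rn n) M]
    [IsManifold (𝓡 n) ∞ M] {w : Fin n → ℕ} (hw : ∀ j, 1 ≤ w j) {a : M}
    {φ : OpenPartialHomeomorph M (Carnot.Rn n)} (hφ : Carnot.IsCenteredChart φ a)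
    {X : Fin n → (x : M) → TangentSpace (𝓡 n) x} (hX : ∀ j, Carnot.SmoothVFOn (X j) φ.source) :
    (Carnot.LinearlyAdapted φ X →
      List.TFAE [
        Carnot.IsPrivileged w φ a X,
        ∀ j, Carnot.HasHomogeneousModel w φ.target (Carnot.coordVF φ (X j)) (w j),
        ∀ j, Carnot.DiffOpHasWeight w φ.target (Carnot.vfOp (Carnot.coordVF φ (X j))) (-(w j : ℤ)),
        ∀ α : Fin n → ℕ, Carnot.DiffOpHasWeight w φ.target
          (Carnot.monomial (fun j => Carnot.vfOp (Carnot.coordVF φ (X j))) α)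
          (-(Carnot.wlen w α : ℤ))]) ∧
    (Carnot.IsPrivileged w φ a X ↔ Carnot.IsGoodmanPrivileged w φ X) := by
  have h0 : (0 : Carnot.Rn n) ∈ φ.target := hφ.map_eq_zero ▸ φ.map_source hφ.mem_source
  have hU : φ.target ∈ 𝓝 0 := φ.open_target.mem_nhds h0
  have smooth (j : Fin n) := Carnot.contDiffOn_coordVF hφ.mem_maximalAtlas (hX j)
  have smooth_zero (j : Fin n) := (smooth j).contDiffAt hU
  have goodman_iff : Carnot.IsGoodmanPrivileged w φ X ↔ Carnot.LinearlyAdapted φ X ∧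
      Carnot.ComponentsWeightGE w fun j => Carnot.coordVF φ (X j) :=
    and_congr_right fun _ => forall_congr' fun j =>
      Carnot.hasHomogeneousModel_iff h0 hw (smooth_zero j)
  have privileged_iff : Carnot.IsPrivileged w φ a X ↔ Carnot.IsGoodmanPrivileged w φ X := by
    rw [goodman_iff, Carnot.isPrivileged_iff_orderGE hφ w hX]
    exact and_congr_right fun hlin =>
      (Carnot.componentsWeightGE_iff_orderGE_coord smooth_zero hlin).symm
  refine ⟨fun hlin => ?_, privileged_iff⟩
  tfae_have 1 ↔ 2 := privileged_iff.trans (and_iff_right hlin)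
  tfae_have 2 → 4 := fun h α =>
    (goodman_iff.1 ⟨hlin, h⟩).2.diffOpHasWeight_monomial φ.open_target h0 smooth hlin α
  tfae_have 4 → 3 := fun h j => by
    simpa only [Carnot.monomial_single, Carnot.wlen_single] using h (Pi.single j 1)
  tfae_have 3 → 2 := fun h =>
    (goodman_iff.2 ⟨hlin, .of_diffOpHasWeight hU smooth_zero h⟩).2
  tfae_finish

theorem theorem5p1 {n : ℕ} {M : Type*} [TopologicalSpace M] [T2Space M]
    [ChartedSpace (Carnot.Rn n) M] [IsManifold (𝓡 n) ∞ M]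
    (C : Carnot.CarnotStructure n M) (a : M)
    (φ : OpenPartialHomeomorph M (Carnot.Rn n)) (hφ : Carnot.IsCenteredChart φ a)
    (X : Fin n → (x : M) → TangentSpace (𝓡 n) x) (hX : Carnot.IsHFrameOn C X φ.source) :
    (Carnot.LinearlyAdapted φ X →
      List.TFAE [
        Carnot.IsPrivileged C.weight φ a X,
        ∀ j, Carnot.HasHomogeneousModel C.weight φ.target (Carnot.coordVF φ (X j)) (C.weight j),
        ∀ j, Carnot.DiffOpHasWeight C.weight φ.target
          (Carnot.vfOp (Carnot.coordVF φ (X j))) (-(C.weight j : ℤ)),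
        ∀ α : Fin n → ℕ, Carnot.DiffOpHasWeight C.weight φ.target
          (Carnot.monomial (fun j => Carnot.vfOp (Carnot.coordVF φ (X j))) α)
          (-(Carnot.wlen C.weight α : ℤ))]) ∧
    (Carnot.IsPrivileged C.weight φ a X ↔ Carnot.IsGoodmanPrivileged C.weight φ X) :=
  theorem5p1_general (C.one_le_weight a) hφ hX.smooth
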